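/- **Setting.** Let $X$ be a compact metric space with its Borel $\sigma$-algebra, $r:X\to X$ a measurable map of $X$ onto itself with $\#r^{-1}(x)<\infty$ for all $x$, and $\mu$ a Borel probability measure on $X$ that is strongly $r$-invariant: for all bounded measurable $f$, $$\int_X f\,d\mu=\int_X\frac1{\#r^{-1}(x)}\sum_{r(y)=x}f(y)\,d\mu(x).$$ For $m_0\in L^\infty(X,\mu)$ put $(R_{m_0}\xi)(x)=\frac1{\#r^{-1}(x)}\sum_{r(y)=x}|m_0(y)|^2\xi(y)$. A Perron–Ruelle–Frobenius pair is a pair $(m_0,h)$ with $m_0\in L^\infty(X,\mu)$ complex-valued, $h\in L^1(X,\mu)$, $h\ge 0$ and $R_{m_0}h=h$ $\mu$-a.e. The function $m_0$ is non-singular if $m_0\neq0$ $\mu$-a.e. Let $X_\infty=\{\hat x=(x_0,x_1,\dots): r(x_{n+1})=x_n \text{ for all } n\ge 0\}$ and $\theta_n(\hat x)=x_n$. Equip $X_\infty$ with the $\sigma$-algebra $\mathfrak B_\infty$ generated by the maps $\theta_n$, and let $\hat r(\hat x)=(r(x_0),x_0,x_1,\dots)$. Functions $g$ on $X$ are read as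 the functions $g\circ\theta_0$ on $X_\infty$. For a pair $(m_0,h)$ let $\hat\mu$ be the finite measure on $X_\infty$ with $$\int_{X_\infty}f\circ\theta_n\,d\hat\mu=\int_X R_{m_0}^n(fh)\,d\mu\qquad(n\ge0,\ f\text{ bounded measurable on }X).$$ The associated covariant system consists of $L^2(X_\infty,\hat\mu)$, $U\xi=m_0\cdot\xi\circ\hat r$, $\pi(g)\xi=g\xi$ for $g\in L^\infty(X,\mu)$, and $\varphi=1$. Let $E_0^{\hat\mu}(f)$ be the conditional expectation of $f$ with respect to $\hat\mu$ and the $\sigma$-algebra generated by $\theta_0$, written as a function on $X$. **Theorem.** Let $(m_0,h)$ and $(m_0',h')$ be Perron–Ruelle–Frobenius pairs with $m_0,m_0'$ non-singular, with covariant systems $(L^2(X_\infty,\hat\mu),U,\pi,\varphi)$ and $(L^2(X_\infty,\hat\mu'),U',\pi',\varphi')$. Let $X_\infty=X_\infty^a\cup X_\infty^s$ be a partition into measurable sets with $\hat\mu(X_\infty^s)=0$ and $\hat\mu'|_{X_\infty^a}\ll\hat\mu$, and let $\Delta=\frac{d(\hat\mu'|_{X_\infty^a})}{d\hat\mu}$.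 Then there are one-to-one correspondences between each two of the following sets: 1. bounded operators $A:L^2(X_\infty,\hat\mu)\to L^2(X_\infty,\hat\mu')$ with $U'A=AU$ and $\pi'(g)A=A\pi(g)$ for all $g\in L^\infty(X,\mu)$; 2. $\mathfrak B_\infty$-measurable functions $f:X_\infty\to\mathbb C$ such that $f|_{X_\infty^s}=0$, $f\Delta^{1/2}$ is $\hat\mu$-essentially bounded, and $m_0f=m_0'\,f\circ\hat r$ $\hat\mu'$-a.e., where functions equal $\hat\mu'$-a.e. are identified; 3. measurable functions $h_0:X\to\mathbb C$ such that $|h_0|^2\le c\,hh'$ $\mu$-a.e. for some finite constant $c\ge0$ and $$\frac1{\#r^{-1}(x)}\sum_{r(y)=x}\overline{m_0'(y)}\,m_0(y)\,h_0(y)=h_0(x)\quad\text{for }\mu\text{-a.e. }x\in X,$$ where functions equal $\mu$-a.e. are identified. From (1) to (2) the correspondence is given by $A\xi=f\xi$ for $\xi\in L^2(X_\infty,\hat\mu)$. From (2) to (3) it is given by $h_0=E_0^{\hat\mu'}(f)\,h'=E_0^{\hat\mu}(f\Delta)\,h$. From (1) to (3) it is the composition of these two, and it is given by $$\langle\varphi',A\pi(g)\varphi\rangle=\int_X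 g\,h_0\,d\mu\qquad(g\in L^\infty(X,\mu)),$$ where the inner product is linear in the second argument. -/

import Mathlib

open MeasureTheory Filter
open scoped ENNReal ComplexConjugate

noncomputable section

namespace Ruelle

variable {X : Type*}

/-! ### Fibre averages and Ruelle operators -/

/-- The average `(1 / #r⁻¹(x)) ∑_{r(y) = x} f(y)` of `f` over the (finite) fibre of `r` at `x`. -/
def fibreAvg (r : X → X) (f : X → ℂ) (x : X) : ℂ :=
  ((r ⁻¹' {x}).ncard : ℂ)⁻¹ * ∑ᶠ y ∈ r ⁻¹' {x}, f y

/-- The Ruelle operator `(R ξ)(x) = (1 / #r⁻¹(x)) ∑_{r(y) = x} |m₀(y)|² ξ(y)`. -/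
def ruelleOp (r : X → X) (m₀ : X → ℂ) (ξ : X → ℂ) : X → ℂ :=
  fibreAvg r fun y => ((‖m₀ y‖ ^ 2 : ℝ) : ℂ) * ξ y

/-- The mixed Ruelle operator
`ξ ↦ (x ↦ (1 / #r⁻¹(x)) ∑_{r(y) = x} conj (m₀'(y)) m₀(y) ξ(y))`. -/
def mixedRuelleOp (r : X → X) (m₀ m₀' : X → ℂ) (ξ : X → ℂ) : X → ℂ :=
  fibreAvg r fun y => conj (m₀' y) * m₀ y * ξ y

variable [MeasurableSpace X]

/-- Strong invariance: `∫ f dμ = ∫ (1 / #r⁻¹(x)) ∑_{r(y) = x} f(y) dμ(x)` for all bounded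
measurable `f`. (Applied to `f` and to `f + 1`, this forces the fibre averages to be integrable.) -/
def StronglyInvariant (r : X → X) (μ : Measure X) : Prop :=
  ∀ f : X → ℂ, Measurable f → (∃ C : ℝ, ∀ x, ‖f x‖ ≤ C) →
    ∫ x, f x ∂μ = ∫ x, fibreAvg r f x ∂μ

/-- `(m₀, h)` is a Perron–Ruelle–Frobenius pair: `m₀ ∈ L^∞(X, μ)`, `h ∈ L¹(X, μ)`, `h ≥ 0`
and `R_{m₀} h = h`. -/
structure IsPRFPair (r : X → X) (μ : Measure X) (m₀ : X → ℂ) (h : X → ℝ) : Prop where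
  memLp_top : MemLp m₀ ∞ μ
  integrable : Integrable h μ
  nonneg : 0 ≤ᵐ[μ] h
  ruelle_eq : ruelleOp r m₀ (fun x => (h x : ℂ)) =ᵐ[μ] fun x => (h x : ℂ)

/-- `m₀` is non-singular: it does not vanish on a set of positive measure. -/
def NonSingular (μ : Measure X) (m₀ : X → ℂ) : Prop :=
  ∀ᵐ x ∂μ, m₀ x ≠ 0

/-! ### The projective limit -/

/-- The projective limit `X_∞` of `X ← X ← X ← ⋯` along `r`, with the σ-algebra generated by the
coordinate maps. -/
abbrev ProjLim (r : X → X) : Type _ :=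
  {x : ℕ → X // ∀ n, r (x (n + 1)) = x n}

/-- The coordinate map `θ_n : X_∞ → X`. -/
def theta (r : X → X) (n : ℕ) (x : ProjLim r) : X := x.1 n

/-- The automorphism `r̂ (x₀, x₁, …) = (r(x₀), x₀, x₁, …)` of `X_∞`. -/
def rHat (r : X → X) (x : ProjLim r) : ProjLim r :=
  ⟨fun n => Nat.casesOn n (r (x.1 0)) x.1, fun n => by
    cases n with
    | zero => rfl
    | succ n => exact x.2 n⟩

/-- `ν` is a finite measure on `X_∞` with `ν ∘ θ_n⁻¹ = ω_n` for all `n`, where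
`ω_n(f) = ∫ Rⁿ(f h) dμ` for bounded measurable `f`. -/
structure IsPathMeasure (r : X → X) (μ : Measure X) (m₀ : X → ℂ) (h : X → ℝ)
    (ν : Measure (ProjLim r)) : Prop where
  finite : IsFiniteMeasure ν
  marginal : ∀ (n : ℕ) (f : X → ℂ), Measurable f → (∃ C : ℝ, ∀ x, ‖f x‖ ≤ C) →
    ∫ x, f (theta r n x) ∂ν = ∫ x, (ruelleOp r m₀)^[n] (fun y => f y * (h y : ℂ)) x ∂μ

/-- The measure `μ̂` on `X_∞` attached to `(m₀, h)`: the measure with `μ̂ ∘ θ_n⁻¹ = ω_n` for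
all `n`. For a strongly invariant probability measure `μ` on a compact metric space and a
Perron–Ruelle–Frobenius pair it exists and is unique, because `ω_{n+1}(f ∘ r) = ω_n(f)` and the
sets `θ_n⁻¹(E)` form a π-system that generates the σ-algebra of `X_∞`. -/
def pathMeasure (r : X → X) (μ : Measure X) (m₀ : X → ℂ) (h : X → ℝ) : Measure (ProjLim r) :=
  Classical.epsilon (IsPathMeasure r μ m₀ h)

/-! ### The covariant system on `L²(X_∞, ν)` -/

open Classical in
/-- The class in `L²(ν)` of a function (`0` if the function is not square integrable). -/
def toL2 {Ω : Type*} [MeasurableSpace Ω] (ν : Measure Ω) (F : Ω → ℂ) : Lp ℂ 2 ν :=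
  if hF : MemLp F 2 ν then hF.toLp F else 0

/-- `U ξ = m₀ · ξ ∘ r̂`, where `m₀` is read as the function `m₀ ∘ θ₀` on `X_∞`. For `ν = μ̂` the
function is square integrable, with the norm of `ξ`, because `d(μ̂ ∘ r̂) / dμ̂ = |m₀|²`. -/
def covU (r : X → X) (m₀ : X → ℂ) (ν : Measure (ProjLim r)) (ξ : Lp ℂ 2 ν) : Lp ℂ 2 ν :=
  toL2 ν fun x => m₀ (theta r 0 x) * ξ (rHat r x)

/-- `π(g) ξ = g ξ`, where `g` is read as the function `g ∘ θ₀` on `X_∞`. For `ν = μ̂` and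
`g ∈ L^∞(X, μ)` the function is square integrable, because `μ̂ ∘ θ₀⁻¹ = h μ`. -/
def covPi (r : X → X) (ν : Measure (ProjLim r)) (g : X → ℂ) (ξ : Lp ℂ 2 ν) : Lp ℂ 2 ν :=
  toL2 ν fun x => g (theta r 0 x) * ξ x

/-- The vector `φ = 1`. -/
def covPhi (r : X → X) (ν : Measure (ProjLim r)) : Lp ℂ 2 ν :=
  toL2 ν fun _ => 1

/-! ### The conditional expectation onto functions of `x₀` -/

/-- A function measurable for the σ-algebra generated by `θ₀` is a function of `x₀`. -/
theorem exists_condExp_eq_comp (r : X → X) (ν : Measure (ProjLim r)) (f : ProjLim r → ℂ) :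
    ∃ ξ : X → ℂ, Measurable ξ ∧
      ν[f | MeasurableSpace.comap (theta r 0) inferInstance] = ξ ∘ theta r 0 :=
  stronglyMeasurable_condExp.measurable.exists_eq_measurable_comp

/-- `E₀^ν(f)`, the conditional expectation of `f` with respect to the σ-algebra generated by `θ₀`,
written as a function on `X`. -/
def condE₀ (r : X → X) (ν : Measure (ProjLim r)) (f : ProjLim r → ℂ) : X → ℂ :=
  (exists_condExp_eq_comp r ν f).choose

/-! ### The three sets of data -/

/-- Bounded operators `A : L²(X_∞, ν) → L²(X_∞, ν')` with `U' A = A U` and `π'(g) A = A π(g)` for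
all `g ∈ L^∞(X, μ)`. -/
def intertwiners (r : X → X) (μ : Measure X) (m₀ m₀' : X → ℂ) (ν ν' : Measure (ProjLim r)) :
    Set (Lp ℂ 2 ν →L[ℂ] Lp ℂ 2 ν') :=
  {A | (∀ ξ, covU r m₀' ν' (A ξ) = A (covU r m₀ ν ξ)) ∧
    ∀ g : X → ℂ, MemLp g ∞ μ → ∀ ξ, covPi r ν' g (A ξ) = A (covPi r ν g ξ)}

/-- `Δ`, the density with respect to `ν` of the restriction of `ν'` to the complement of the
singular part `S`. -/
def density {Ω : Type*} [MeasurableSpace Ω] (ν ν' : Measure Ω) (S : Set Ω) (x : Ω) : ℝ :=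
  ((ν'.restrict Sᶜ).rnDeriv ν x).toReal

/-- Measurable `f : X_∞ → ℂ` with `f = 0` on the singular part `S`, with `f Δ^{1/2}` essentially
bounded for `ν`, and with `m₀ f = m₀' f ∘ r̂` almost everywhere for `ν'`. -/
structure IsMultiplier (r : X → X) (m₀ m₀' : X → ℂ) (ν ν' : Measure (ProjLim r))
    (S : Set (ProjLim r)) (f : ProjLim r → ℂ) : Prop where
  measurable : Measurable f
  eq_zero : ∀ x ∈ S, f x = 0
  bounded : ∃ C : ℝ, ∀ᵐ x ∂ν, ‖f x * (Real.sqrt (density ν ν' S x) : ℂ)‖ ≤ C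
  cocycle : ∀ᵐ x ∂ν', m₀ (theta r 0 x) * f x = m₀' (theta r 0 x) * f (rHat r x)

/-- The functions satisfying `IsMultiplier`, up to equality `ν'`-almost everywhere. -/
def multipliers (r : X → X) (m₀ m₀' : X → ℂ) (ν ν' : Measure (ProjLim r))
    (S : Set (ProjLim r)) : Set (ProjLim r →ₘ[ν'] ℂ) :=
  {F | ∃ f, IsMultiplier r m₀ m₀' ν ν' S f ∧ F =ᵐ[ν'] f}

/-- Measurable `h₀ : X → ℂ` with `|h₀|² ≤ c h h'` for some finite `c ≥ 0`, fixed by the mixed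
Ruelle operator, both almost everywhere. -/
structure IsMixedHarmonic (r : X → X) (μ : Measure X) (m₀ m₀' : X → ℂ) (h h' : X → ℝ)
    (h₀ : X → ℂ) : Prop where
  measurable : Measurable h₀
  bounded : ∃ c : ℝ, 0 ≤ c ∧ ∀ᵐ x ∂μ, ‖h₀ x‖ ^ 2 ≤ c * h x * h' x
  fixed : ∀ᵐ x ∂μ, mixedRuelleOp r m₀ m₀' h₀ x = h₀ x

/-- The functions satisfying `IsMixedHarmonic`, up to equality `μ`-almost everywhere. -/
def mixedHarmonics (r : X → X) (μ : Measure X) (m₀ m₀' : X → ℂ) (h h' : X → ℝ) :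
    Set (X →ₘ[μ] ℂ) :=
  {H | ∃ h₀, IsMixedHarmonic r μ m₀ m₀' h h' h₀ ∧ H =ᵐ[μ] h₀}

end Ruelle

end

/-!
Bounded operators that intertwine two covariant systems are multiplications by functions `f` on
the projective limit `X_∞`, and these functions are determined by their conditional expectations
onto functions of the first coordinate.

Write `ν = μ̂` and `ν' = μ̂'`. Strong invariance gives `ν` the marginals `|m₀⁽ⁿ⁾|² h μ`
(`IsRegularPair.isPathMeasure_iff`), where `m₀⁽ⁿ⁾ = m₀ · m₀∘r ⋯ m₀∘rⁿ⁻¹`; such a measure exists by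
the Ionescu-Tulcea theorem (`exists_measure_projLim`). Comparison of marginals shows that the shift
`r̂` carries `|m₀ ∘ θ₀|² ν` to `ν` (`IsCovariantSystem.map_rHat`), so that `U` is isometric and `r̂`
preserves `ν`-null sets.

*Operators and functions on `X_∞`.* As `U π(g ∘ r) = π(g) U` on the level of coordinates, an
intertwiner `A` commutes with multiplication by functions of every coordinate `x_n`, hence
`A 1_E = 1_E f` for all cylinders `E`, with `f = A 1`. So `|f|² ν' ≤ ‖A‖² ν` on cylinders, therefore
on all measurable sets, and `A` is multiplication by `f` (`exists_isDominated_of_commute`). The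
inequality `|f|² ν' ≤ C ν` says exactly that `f` vanishes on the singular part and that `f Δ^{1/2}`
is essentially bounded. The relation `U' A = A U` is the cocycle equation `m₀ f = m₀' f ∘ r̂`.

*From functions on `X_∞` to functions on `X`.* The function `h₀ = E₀(f) h'` is the density of the
image of `f ν'` under `θ₀`. Integration of the cocycle equation shows that `h₀` is fixed by the
mixed Ruelle operator (`mixedRuelleOp_condE₀_mul`), and that all the integrals `∫ g(x_n) f dν'` are
determined by `h₀`, hence `f` is (`ae_eq_zero_of_cocycle`). The bound `|h₀|² ≤ C h h'` follows from
`|f|² ν' ≤ C ν` (`norm_condE₀_mul_sq_le`).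

*From functions on `X` to functions on `X_∞`.* For a fixed point `h₀` the functions
`m₀⁽ⁿ⁾ h₀ / (m₀'⁽ⁿ⁾ h')` of `x_n` form a martingale that is bounded in `L²(ν')`, because of
`|h₀|² ≤ c h h'`. Its limit is the required multiplier (`IsMixedHarmonic.exists_isMultiplier`).

All of this is carried out for measurable representatives of `m₀` and `h` that are bounded and
non-zero, respectively non-negative, everywhere (`IsRegularPair`).
-/

namespace Ruelle

open MeasureTheory Filter
open scoped ENNReal NNReal ComplexConjugate Topology symmDiff

section

/-! ### Strong invariance and fibre averages -/

variable {X : Type*} {r : X → X}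

theorem fibreAvg_eq_sum (hfin : ∀ x, (r ⁻¹' {x}).Finite) (f : X → ℂ) (x : X) :
    fibreAvg r f x = ((r ⁻¹' {x}).ncard : ℂ)⁻¹ * ∑ y ∈ (hfin x).toFinset, f y := by
  rw [fibreAvg, finsum_mem_eq_finite_toFinset_sum]

theorem fibreAvg_congr {f g : X → ℂ} {x : X} (hfg : ∀ y, r y = x → f y = g y) :
    fibreAvg r f x = fibreAvg r g x := by
  rw [fibreAvg, fibreAvg]
  congr 1
  exact finsum_mem_congr rfl fun y hy => hfg y hy

theorem fibreAvg_add (hfin : ∀ x, (r ⁻¹' {x}).Finite) (f g : X → ℂ) :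
    fibreAvg r (fun y => f y + g y) = fun x => fibreAvg r f x + fibreAvg r g x := by
  ext x
  simp only [fibreAvg_eq_sum hfin, Finset.sum_add_distrib, mul_add]

theorem fibreAvg_sub (hfin : ∀ x, (r ⁻¹' {x}).Finite) (f g : X → ℂ) :
    fibreAvg r (fun y => f y - g y) = fun x => fibreAvg r f x - fibreAvg r g x := by
  ext x
  simp only [fibreAvg_eq_sum hfin, Finset.sum_sub_distrib, mul_sub]

/-- Functions of `r y` may be pulled out of the fibre average. -/
theorem fibreAvg_comp_mul (hfin : ∀ x, (r ⁻¹' {x}).Finite) (g f : X → ℂ) :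
    fibreAvg r (fun y => g (r y) * f y) = fun x => g x * fibreAvg r f x := by
  ext x
  rw [fibreAvg_congr (g := fun y => g x * f y) fun y hy => by rw [hy]]
  simp only [fibreAvg_eq_sum hfin, ← Finset.mul_sum]
  ring

theorem fibreAvg_one (hfin : ∀ x, (r ⁻¹' {x}).Finite) (honto : Function.Surjective r) :
    fibreAvg r (fun _ => 1) = fun _ => 1 := by
  ext x
  have h : (r ⁻¹' {x}).ncard ≠ 0 := by
    obtain ⟨y, hy⟩ := honto x
    exact ((Set.ncard_pos (hfin x)).2 ⟨y, hy⟩).ne'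
  rw [fibreAvg_eq_sum hfin, Finset.sum_const, ← Set.ncard_eq_toFinset_card _ (hfin x),
    nsmul_eq_mul, mul_one]
  exact inv_mul_cancel₀ (Nat.cast_ne_zero.2 h)

theorem fibreAvg_norm (hfin : ∀ x, (r ⁻¹' {x}).Finite) (f : X → ℂ) (x : X) :
    fibreAvg r (fun y => (‖f y‖ : ℂ)) x =
      (((r ⁻¹' {x}).ncard : ℝ)⁻¹ * ∑ y ∈ (hfin x).toFinset, ‖f y‖ : ℝ) := by
  rw [fibreAvg_eq_sum hfin]
  push_cast
  rfl

theorem norm_fibreAvg_le (hfin : ∀ x, (r ⁻¹' {x}).Finite) (f : X → ℂ) (x : X) :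
    ‖fibreAvg r f x‖ ≤ ‖fibreAvg r (fun y => (‖f y‖ : ℂ)) x‖ := by
  rw [fibreAvg_norm hfin, fibreAvg_eq_sum hfin, Complex.norm_real, norm_mul, norm_mul]
  simp only [norm_inv, Complex.norm_natCast, Real.norm_natCast]
  gcongr
  exact (norm_sum_le _ _).trans (le_abs_self _)

theorem norm_le_ncard_mul_fibreAvg (hfin : ∀ x, (r ⁻¹' {x}).Finite) (f : X → ℂ) (y : X) :
    ‖f y‖ ≤ (r ⁻¹' {r y}).ncard * ‖fibreAvg r (fun y => (‖f y‖ : ℂ)) (r y)‖ := by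
  have hy : y ∈ (hfin (r y)).toFinset := by simp
  have h : ((r ⁻¹' {r y}).ncard : ℝ) ≠ 0 := by
    exact Nat.cast_ne_zero.2 ((Set.ncard_pos (hfin (r y))).2 ⟨y, rfl⟩).ne'
  rw [fibreAvg_norm hfin, Complex.norm_real, norm_mul, norm_inv, Real.norm_natCast,
    mul_inv_cancel_left₀ h]
  exact (Finset.single_le_sum (f := fun y => ‖f y‖) (fun _ _ => norm_nonneg _) hy).trans
    (le_abs_self _)

variable [MeasurableSpace X] {μ : Measure X} [IsProbabilityMeasure μ]

/-- The standing assumptions on the dynamics: a measurable finite-to-one surjection together with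
a strongly invariant measure. -/
structure IsDynamics (r : X → X) (μ : Measure X) : Prop where
  measurable : Measurable r
  onto : Function.Surjective r
  finite : ∀ x, (r ⁻¹' {x}).Finite
  invariant : StronglyInvariant r μ

namespace IsDynamics

variable (D : IsDynamics r μ)
include D

/-- If the fibre average of a bounded `f` were not integrable, neither would be that of `f + 1`,
and strong invariance would give `∫ f = 0 = ∫ (f + 1)`. -/
theorem integrable_fibreAvg_of_bounded {f : X → ℂ} (hf : Measurable f) {C : ℝ}
    (hC : ∀ x, ‖f x‖ ≤ C) : Integrable (fibreAvg r f) μ := by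
  by_contra hn
  have hfi : Integrable f μ := .of_bound hf.aestronglyMeasurable C (.of_forall hC)
  have h1 := D.invariant f hf ⟨C, hC⟩
  have h2 := D.invariant (fun x => f x + 1) (hf.add_const 1)
    ⟨C + 1, fun x => (norm_add_le _ _).trans (by simpa using hC x)⟩
  have hn' : ¬ Integrable (fibreAvg r fun x => f x + 1) μ := by
    rw [fibreAvg_add D.finite, fibreAvg_one D.finite D.onto]
    intro hi
    exact hn ((hi.sub (integrable_const (1 : ℂ))).congr (.of_forall fun x => by simp))
  rw [integral_undef hn] at h1
  rw [integral_undef hn', integral_add hfi (integrable_const 1), h1] at h2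
  simp at h2

/-- The fibre of almost every point avoids a given null set. -/
theorem ae_fibre {p : X → Prop} (hp : ∀ᵐ y ∂μ, p y) : ∀ᵐ x ∂μ, ∀ y, r y = x → p y := by
  obtain ⟨N, hpN, hN, hN0⟩ := exists_measurable_superset_of_null (ae_iff.1 hp)
  let f : X → ℂ := N.indicator 1
  have hf : Measurable f := measurable_const.indicator hN
  have hfC : ∀ x, ‖f x‖ ≤ 1 := fun x => by
    by_cases hx : x ∈ N <;> simp [f, hx]
  have hff : f = fun y => (‖f y‖ : ℂ) := by
    ext y
    by_cases hx : y ∈ N <;> simp [f, hx]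
  have h0 : ∫ x, f x ∂μ = 0 := by
    apply integral_eq_zero_of_ae
    filter_upwards [measure_eq_zero_iff_ae_notMem.1 hN0] with x hx
    simp [f, hx]
  rw [D.invariant f hf ⟨1, hfC⟩] at h0
  have hI := D.integrable_fibreAvg_of_bounded hf hfC
  have hre : (fun x => (‖fibreAvg r f x‖ : ℂ)) = fibreAvg r f := by
    ext x
    rw [hff, fibreAvg_norm D.finite, Complex.norm_real, Real.norm_of_nonneg]
    positivity
  rw [← hre, integral_complex_ofReal, Complex.ofReal_eq_zero,
    integral_eq_zero_iff_of_nonneg (fun _ => norm_nonneg _) hI.norm] at h0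
  filter_upwards [h0] with x hx y hy
  by_contra hpy
  have hyN : y ∈ N := hpN hpy
  have := norm_le_ncard_mul_fibreAvg D.finite f y
  rw [← hff, hy, show ‖fibreAvg r f x‖ = 0 from hx] at this
  simp [f, hyN] at this
  linarith

theorem fibreAvg_congr_ae {f g : X → ℂ} (hfg : f =ᵐ[μ] g) : fibreAvg r f =ᵐ[μ] fibreAvg r g := by
  filter_upwards [D.ae_fibre hfg] with x hx
  exact fibreAvg_congr hx

/-- Fibre averages contract the `L¹`-seminorm; the general case follows from that of bounded
functions by truncation and Fatou's lemma. -/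
theorem fibreAvg_bound {f : X → ℂ} (hf : Measurable f) :
    AEStronglyMeasurable (fibreAvg r f) μ ∧
      ∫⁻ x, ‖fibreAvg r f x‖ₑ ∂μ ≤ ∫⁻ x, ‖f x‖ₑ ∂μ := by
  let F : ℕ → X → ℂ := fun n => {x | ‖f x‖ ≤ n}.indicator f
  have hF : ∀ n, Measurable (F n) := fun n => hf.indicator (measurableSet_le hf.norm (by fun_prop))
  have hFle : ∀ n x, ‖F n x‖ ≤ ‖f x‖ := fun n x => norm_indicator_le_norm_self _ _
  have hFC : ∀ n x, ‖F n x‖ ≤ n := fun n x => by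
    by_cases hx : ‖f x‖ ≤ n <;> simp [F, hx]
  have hI := fun n => D.integrable_fibreAvg_of_bounded (hF n) (hFC n)
  have hFlim : ∀ x, Tendsto (fun n => F n x) atTop (𝓝 (f x)) := by
    intro x
    obtain ⟨N, hN⟩ := exists_nat_ge ‖f x‖
    apply tendsto_const_nhds.congr'
    filter_upwards [eventually_ge_atTop N] with n hn
    have : ‖f x‖ ≤ n := hN.trans (by exact_mod_cast hn)
    simp [F, this]
  have hlim : ∀ x, Tendsto (fun n => fibreAvg r (F n) x) atTop (𝓝 (fibreAvg r f x)) := by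
    intro x
    simp only [fibreAvg_eq_sum D.finite]
    exact (tendsto_finsetSum _ fun y _ => hFlim y).const_mul _
  have hm : AEStronglyMeasurable (fibreAvg r f) μ :=
    aestronglyMeasurable_of_tendsto_ae atTop (fun n => (hI n).1) (.of_forall hlim)
  refine ⟨hm, ?_⟩
  have hb : ∀ n, ∫⁻ x, ‖fibreAvg r (F n) x‖ₑ ∂μ ≤ ∫⁻ x, ‖f x‖ₑ ∂μ := by
    intro n
    have hnm : Measurable fun y => (‖F n y‖ : ℂ) := by have := hF n; fun_prop
    have hnC : ∀ y, ‖(‖F n y‖ : ℂ)‖ ≤ n := fun y => by simpa using hFC n y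
    have hnI := D.integrable_fibreAvg_of_bounded hnm hnC
    have hFi : Integrable (F n) μ := .of_bound (hF n).aestronglyMeasurable n (.of_forall (hFC n))
    have e1 : ∫ x, ‖fibreAvg r (fun y => (‖F n y‖ : ℂ)) x‖ ∂μ = ∫ x, ‖F n x‖ ∂μ := by
      apply Complex.ofReal_injective
      rw [← integral_complex_ofReal, ← integral_complex_ofReal, D.invariant _ hnm ⟨n, hnC⟩]
      congr 1
      ext x
      rw [fibreAvg_norm D.finite, Complex.norm_real, Real.norm_of_nonneg]
      positivity
    calc ∫⁻ x, ‖fibreAvg r (F n) x‖ₑ ∂μ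
        ≤ ∫⁻ x, ‖fibreAvg r (fun y => (‖F n y‖ : ℂ)) x‖ₑ ∂μ :=
          lintegral_mono fun x => enorm_le_iff_norm_le.2 (norm_fibreAvg_le D.finite _ x)
      _ = ENNReal.ofReal (∫ x, ‖fibreAvg r (fun y => (‖F n y‖ : ℂ)) x‖ ∂μ) :=
          (ofReal_integral_norm_eq_lintegral_enorm hnI).symm
      _ = ENNReal.ofReal (∫ x, ‖F n x‖ ∂μ) := by rw [e1]
      _ = ∫⁻ x, ‖F n x‖ₑ ∂μ := ofReal_integral_norm_eq_lintegral_enorm hFi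
      _ ≤ _ := lintegral_mono fun x => enorm_le_iff_norm_le.2 (hFle n x)
  calc ∫⁻ x, ‖fibreAvg r f x‖ₑ ∂μ
      = ∫⁻ x, liminf (fun n => ‖fibreAvg r (F n) x‖ₑ) atTop ∂μ := by
        congr 1; ext x; exact ((hlim x).enorm.liminf_eq).symm
    _ ≤ liminf (fun n => ∫⁻ x, ‖fibreAvg r (F n) x‖ₑ ∂μ) atTop :=
        lintegral_liminf_le' fun n => (hI n).1.enorm
    _ ≤ _ := liminf_le_of_le (by isBoundedDefault) fun b hb' => by
        obtain ⟨n, hn⟩ := hb'.exists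
        exact hn.trans (hb n)

theorem integrable_fibreAvg {f : X → ℂ} (hf : Integrable f μ) : Integrable (fibreAvg r f) μ := by
  obtain ⟨g, hg, hfg⟩ := hf.1.aemeasurable
  have hb := D.fibreAvg_bound hg
  refine Integrable.congr ⟨hb.1, hb.2.trans_lt (hf.congr hfg).2⟩ (D.fibreAvg_congr_ae hfg.symm)

/-- Strong invariance extends from bounded to integrable functions. -/
theorem integral_fibreAvg {f : X → ℂ} (hf : Integrable f μ) :
    ∫ x, fibreAvg r f x ∂μ = ∫ x, f x ∂μ := by
  obtain ⟨g, hg, hfg⟩ := hf.1.aemeasurable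
  rw [integral_congr_ae (D.fibreAvg_congr_ae hfg), integral_congr_ae hfg]
  replace hf := hf.congr hfg
  clear hfg
  let F : ℕ → X → ℂ := fun n => {x | ‖g x‖ ≤ n}.indicator g
  have hF : ∀ n, Measurable (F n) := fun n => hg.indicator (measurableSet_le hg.norm (by fun_prop))
  have hFC : ∀ n x, ‖F n x‖ ≤ n := fun n x => by
    by_cases hx : ‖g x‖ ≤ n <;> simp [F, hx]
  have hFi : ∀ n, Integrable (F n) μ := fun n =>
    hf.indicator (measurableSet_le hg.norm (by fun_prop))
  have hFlim : ∀ x, Tendsto (fun n => ‖F n x - g x‖ₑ) atTop (𝓝 0) := by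
    intro x
    obtain ⟨N, hN⟩ := exists_nat_ge ‖g x‖
    apply tendsto_const_nhds.congr'
    filter_upwards [eventually_ge_atTop N] with n hn
    have : ‖g x‖ ≤ n := hN.trans (by exact_mod_cast hn)
    simp [F, this]
  have hL : Tendsto (fun n => ∫⁻ x, ‖F n x - g x‖ₑ ∂μ) atTop (𝓝 0) := by
    have := tendsto_lintegral_of_dominated_convergence' (μ := μ) (fun x => ‖g x‖ₑ)
      (F := fun n x => ‖F n x - g x‖ₑ) (f := fun _ => 0)
      (fun n => ((hF n).sub hg).enorm.aemeasurable)
      (fun n => .of_forall fun x => by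
        by_cases hx : ‖g x‖ ≤ n <;> simp [F, hx]) hf.2.ne (.of_forall hFlim)
    simpa using this
  have h1 := tendsto_integral_of_L1 g hf.1 (.of_forall hFi) hL
  have h2 : Tendsto (fun n => ∫ x, fibreAvg r (F n) x ∂μ) atTop
      (𝓝 (∫ x, fibreAvg r g x ∂μ)) := by
    refine tendsto_integral_of_L1 _ (D.integrable_fibreAvg hf).1
      (.of_forall fun n => D.integrable_fibreAvg (hFi n)) ?_
    refine tendsto_of_tendsto_of_tendsto_of_le_of_le tendsto_const_nhds hL (fun _ => zero_le)
      fun n => ?_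
    have := (D.fibreAvg_bound ((hF n).sub hg)).2
    rw [show F n - g = fun y => F n y - g y from rfl, fibreAvg_sub D.finite] at this
    exact this
  refine tendsto_nhds_unique h2 (h1.congr fun n => ?_)
  exact D.invariant _ (hF n) ⟨n, hFC n⟩

end IsDynamics

end

section

/-! ### Cocycle products, marginals and cylinder sets -/

variable {X : Type*} {r : X → X}

/-- The product `m(x) m(r(x)) ⋯ m(rⁿ⁻¹(x))`, the cocycle over `r` generated by `m`. -/
noncomputable def cocycleProd (r : X → X) (m : X → ℂ) (n : ℕ) (x : X) : ℂ :=
  ∏ k ∈ Finset.range n, m (r^[k] x)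

@[simp]
theorem cocycleProd_zero (m : X → ℂ) (x : X) : cocycleProd r m 0 x = 1 := by
  simp [cocycleProd]

theorem cocycleProd_succ (m : X → ℂ) (n : ℕ) (x : X) :
    cocycleProd r m (n + 1) x = m x * cocycleProd r m n (r x) := by
  simp only [cocycleProd, Finset.prod_range_succ', Function.iterate_succ_apply,
    Function.iterate_zero, id, mul_comm]

theorem cocycleProd_succ' (m : X → ℂ) (n : ℕ) (x : X) :
    cocycleProd r m (n + 1) x = cocycleProd r m n x * m (r^[n] x) := by
  simp only [cocycleProd, Finset.prod_range_succ]

theorem cocycleProd_ne_zero {m : X → ℂ} (hm : ∀ x, m x ≠ 0) (n : ℕ) (x : X) :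
    cocycleProd r m n x ≠ 0 :=
  Finset.prod_ne_zero_iff.2 fun _ _ => hm _

theorem norm_cocycleProd_le {m : X → ℂ} {C : ℝ} (hC : ∀ x, ‖m x‖ ≤ C) (n : ℕ) (x : X) :
    ‖cocycleProd r m n x‖ ≤ C ^ n := by
  rw [cocycleProd, norm_prod]
  exact (Finset.prod_le_prod (fun _ _ => norm_nonneg _) fun k _ => hC _).trans (by simp)

theorem iterate_theta (n : ℕ) :
    ∀ (k : ℕ) (x : ProjLim r), r^[n] (theta r (k + n) x) = theta r k x := by
  induction n with
  | zero => intro k x; rfl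
  | succ n ih =>
    intro k x
    rw [Function.iterate_succ_apply, ← ih k x]
    congr 1
    exact x.2 (k + n)

theorem iterate_theta_zero (n : ℕ) (x : ProjLim r) : r^[n] (theta r n x) = theta r 0 x := by
  simpa using iterate_theta n 0 x

@[simp]
theorem theta_succ_rHat (n : ℕ) (x : ProjLim r) : theta r (n + 1) (rHat r x) = theta r n x := rfl

@[simp]
theorem theta_zero_rHat (x : ProjLim r) : theta r 0 (rHat r x) = r (theta r 0 x) := rfl

/-- Finite measures are determined by their real values on measurable sets. -/
theorem measure_ext_of_measureReal {Ω : Type*} [MeasurableSpace Ω] {ρ₁ ρ₂ : Measure Ω}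
    [IsFiniteMeasure ρ₁] [IsFiniteMeasure ρ₂]
    (h : ∀ s, MeasurableSet s → ρ₁.real s = ρ₂.real s) : ρ₁ = ρ₂ := by
  ext s hs
  have := h s hs
  simpa [Measure.real, ENNReal.toReal_eq_toReal_iff'] using this

variable [MeasurableSpace X] {μ : Measure X}

theorem measurable_cocycleProd (hr : Measurable r) {m : X → ℂ} (hm : Measurable m) (n : ℕ) :
    Measurable (cocycleProd r m n) :=
  Finset.measurable_fun_prod _ fun k _ => hm.comp (hr.iterate k)

/-- A Perron–Ruelle–Frobenius pair in which all almost everywhere conditions, except the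
eigenfunction equation, hold everywhere. -/
structure IsRegularPair (r : X → X) (μ : Measure X) (m : X → ℂ) (h : X → ℝ) : Prop where
  measurable : Measurable m
  bounded : ∃ C : ℝ, ∀ x, ‖m x‖ ≤ C
  ne_zero : ∀ x, m x ≠ 0
  measurable_h : Measurable h
  integrable : Integrable h μ
  nonneg : ∀ x, 0 ≤ h x
  ruelle_eq : ruelleOp r m (fun x => (h x : ℂ)) =ᵐ[μ] fun x => (h x : ℂ)

/-- The density of the `n`-th marginal `ω_n` with respect to `μ`, as an extended nonnegative
function. -/
noncomputable def marginalWeight (r : X → X) (m : X → ℂ) (h : X → ℝ) (n : ℕ) (x : X) : ℝ≥0∞ :=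
  ‖cocycleProd r m n x‖ₑ ^ 2 * ENNReal.ofReal (h x)

/-- The marginal `ω_n` of the path measure. -/
noncomputable def marginal (r : X → X) (μ : Measure X) (m : X → ℂ) (h : X → ℝ) (n : ℕ) :
    Measure X :=
  μ.withDensity (marginalWeight r m h n)

theorem measurable_theta (n : ℕ) : Measurable (theta r n) :=
  (measurable_pi_apply n).comp measurable_subtype_coe

theorem measurable_rHat (hr : Measurable r) : Measurable (rHat r) := by
  refine Measurable.subtype_mk (measurable_pi_lambda _ fun n => ?_)
  cases n with
  | zero => exact hr.comp (measurable_theta 0)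
  | succ n => exact measurable_theta n

/-- The sets `θ_n⁻¹(E)`. They form an algebra that generates the `σ`-algebra of `X_∞`. -/
def cylinders (r : X → X) : Set (Set (ProjLim r)) :=
  {s | ∃ n E, MeasurableSet E ∧ theta r n ⁻¹' E = s}

theorem exists_eq_theta_preimage_of_le (hr : Measurable r) {n k : ℕ} (hnk : n ≤ k) {E : Set X}
    (hE : MeasurableSet E) :
    ∃ F, MeasurableSet F ∧ theta r n ⁻¹' E = theta r k ⁻¹' F := by
  obtain ⟨j, rfl⟩ := Nat.exists_eq_add_of_le hnk
  refine ⟨r^[j] ⁻¹' E, hr.iterate j hE, ?_⟩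
  ext x
  simp [iterate_theta j n x]

theorem isSetAlgebra_cylinders (hr : Measurable r) : IsSetAlgebra (cylinders r) where
  empty_mem := ⟨0, ∅, .empty, rfl⟩
  compl_mem := by
    rintro _ ⟨n, E, hE, rfl⟩
    exact ⟨n, Eᶜ, hE.compl, rfl⟩
  union_mem := by
    rintro _ _ ⟨n, E, hE, rfl⟩ ⟨k, F, hF, rfl⟩
    obtain ⟨E', hE', e⟩ := exists_eq_theta_preimage_of_le hr (le_max_left n k) hE
    obtain ⟨F', hF', f⟩ := exists_eq_theta_preimage_of_le hr (le_max_right n k) hF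
    exact ⟨max n k, E' ∪ F', hE'.union hF', by rw [e, f]; rfl⟩

theorem generateFrom_cylinders :
    (inferInstance : MeasurableSpace (ProjLim r)) = MeasurableSpace.generateFrom (cylinders r) := by
  apply le_antisymm
  · let _ : MeasurableSpace (ProjLim r) := MeasurableSpace.generateFrom (cylinders r)
    have h : Measurable fun x : ProjLim r => x.1 := by
      refine measurable_pi_lambda _ fun n => fun E hE => ?_
      exact MeasurableSpace.measurableSet_generateFrom ⟨n, E, hE, rfl⟩
    rintro _ ⟨s, hs, rfl⟩
    exact h hs
  · apply MeasurableSpace.generateFrom_le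
    rintro _ ⟨n, E, hE, rfl⟩
    exact measurable_theta n hE

theorem isPiSystem_cylinders (hr : Measurable r) : IsPiSystem (cylinders r) := by
  intro s hs t ht _
  exact (isSetAlgebra_cylinders hr).inter_mem hs ht

theorem ProjLim.ext_of_theta (hr : Measurable r) {ν₁ ν₂ : Measure (ProjLim r)} [IsFiniteMeasure ν₁]
    (h : ∀ n E, MeasurableSet E → ν₁ (theta r (n + 1) ⁻¹' E) = ν₂ (theta r (n + 1) ⁻¹' E)) :
    ν₁ = ν₂ := by
  have h' : ∀ n E, MeasurableSet E → ν₁ (theta r n ⁻¹' E) = ν₂ (theta r n ⁻¹' E) := by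
    intro n E hE
    obtain ⟨F, hF, e⟩ := exists_eq_theta_preimage_of_le hr n.le_succ hE
    rw [e, h n F hF]
  refine ext_of_generate_finite _ generateFrom_cylinders (isPiSystem_cylinders hr) ?_ ?_
  · rintro _ ⟨n, E, hE, rfl⟩
    exact h' n E hE
  · simpa using h' 0 Set.univ .univ

namespace IsRegularPair

variable {m : X → ℂ} {h : X → ℝ} (P : IsRegularPair r μ m h)
include P

theorem measurable_marginalWeight (hr : Measurable r) (n : ℕ) :
    Measurable (marginalWeight r m h n) :=
  ((measurable_cocycleProd hr P.measurable n).enorm.pow_const 2).mul P.measurable_h.ennreal_ofReal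

theorem toReal_marginalWeight (n : ℕ) (x : X) :
    (marginalWeight r m h n x).toReal = ‖cocycleProd r m n x‖ ^ 2 * h x := by
  simp [marginalWeight, ENNReal.toReal_ofReal (P.nonneg x)]

theorem integral_marginal (hr : Measurable r) (n : ℕ) (f : X → ℂ) :
    ∫ x, f x ∂marginal r μ m h n =
      ∫ x, ((‖cocycleProd r m n x‖ ^ 2 * h x : ℝ) : ℂ) * f x ∂μ := by
  rw [marginal, integral_withDensity_eq_integral_toReal_smul (P.measurable_marginalWeight hr n)]
  · simp only [P.toReal_marginalWeight, Complex.real_smul]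
  · exact .of_forall fun x => by
      simp [marginalWeight, ENNReal.mul_lt_top_iff]

theorem integrable_weight (hr : Measurable r) (n : ℕ) :
    Integrable (fun x => ‖cocycleProd r m n x‖ ^ 2 * h x) μ := by
  obtain ⟨C, hC⟩ := P.bounded
  refine P.integrable.bdd_mul (c := (C ^ n) ^ 2)
    ((measurable_cocycleProd hr P.measurable n).norm.pow_const 2).aestronglyMeasurable
    (.of_forall fun x => ?_)
  rw [norm_pow, norm_norm]
  gcongr
  exact norm_cocycleProd_le hC n x

theorem isFiniteMeasure_marginal (hr : Measurable r) (n : ℕ) :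
    IsFiniteMeasure (marginal r μ m h n) := by
  refine isFiniteMeasure_withDensity ?_
  rw [lintegral_congr fun x => (ENNReal.ofReal_toReal (a := marginalWeight r m h n x) (by
    simp [marginalWeight, ENNReal.mul_eq_top])).symm]
  simp only [P.toReal_marginalWeight]
  exact (P.integrable_weight hr n).lintegral_lt_top.ne

variable [IsProbabilityMeasure μ] (D : IsDynamics r μ)
include D

theorem integral_ruelleOp_iterate (n : ℕ) : ∀ {ξ : X → ℂ}, Integrable ξ μ →
    ∫ x, (ruelleOp r m)^[n] ξ x ∂μ = ∫ x, ((‖cocycleProd r m n x‖ ^ 2 : ℝ) : ℂ) * ξ x ∂μ := by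
  obtain ⟨C, hC⟩ := P.bounded
  induction n with
  | zero => intro ξ _; simp
  | succ n ih =>
    intro ξ hξ
    have hmm := P.measurable
    have h1 : Integrable (fun y => ((‖m y‖ ^ 2 : ℝ) : ℂ) * ξ y) μ := by
      refine hξ.bdd_mul (c := C ^ 2) (by fun_prop) (.of_forall fun x => ?_)
      rw [Complex.norm_real, norm_pow, norm_norm]
      gcongr
      exact hC x
    have hcm := measurable_cocycleProd D.measurable P.measurable n
    have h2 : Integrable (fun y => ((‖cocycleProd r m n (r y)‖ ^ 2 : ℝ) : ℂ) *
        (((‖m y‖ ^ 2 : ℝ) : ℂ) * ξ y)) μ := by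
      have hcr : Measurable fun y => cocycleProd r m n (r y) := hcm.comp D.measurable
      refine h1.bdd_mul (c := (C ^ n) ^ 2)
        (Complex.measurable_ofReal.comp (hcr.norm.pow_const 2)).aestronglyMeasurable
        (.of_forall fun x => ?_)
      rw [Complex.norm_real, norm_pow, norm_norm]
      gcongr
      exact norm_cocycleProd_le hC n _
    rw [Function.iterate_succ_apply, ih (ξ := ruelleOp r m ξ) (D.integrable_fibreAvg h1)]
    have e := fibreAvg_comp_mul D.finite (fun x => ((‖cocycleProd r m n x‖ ^ 2 : ℝ) : ℂ))
      (fun y => ((‖m y‖ ^ 2 : ℝ) : ℂ) * ξ y)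
    calc _ = ∫ x, fibreAvg r (fun y => ((‖cocycleProd r m n (r y)‖ ^ 2 : ℝ) : ℂ) *
        (((‖m y‖ ^ 2 : ℝ) : ℂ) * ξ y)) x ∂μ := by rw [e]; rfl
      _ = _ := by
        rw [D.integral_fibreAvg h2]
        congr 1
        ext x
        rw [cocycleProd_succ, norm_mul]
        push_cast
        ring

/-- The marginals are consistent. This is the eigenfunction equation for `h`. -/
theorem map_marginal_succ (n : ℕ) : (marginal r μ m h (n + 1)).map r = marginal r μ m h n := by
  have hr := D.measurable
  have := P.isFiniteMeasure_marginal hr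
  obtain ⟨C, hC⟩ := P.bounded
  have hcm := measurable_cocycleProd hr P.measurable n
  have hmm := P.measurable
  have hhm := P.measurable_h
  refine measure_ext_of_measureReal fun s hs => ?_
  apply Complex.ofReal_injective
  have e : ∀ (ρ : Measure X) (t : Set X), MeasurableSet t →
      (ρ.real t : ℂ) = ∫ x, t.indicator (fun _ => (1 : ℂ)) x ∂ρ := fun ρ t ht => by
    rw [integral_indicator_const _ ht]; simp
  rw [map_measureReal_apply hr hs, e _ _ (hr hs), e _ _ hs, P.integral_marginal hr,
    P.integral_marginal hr]
  have hg := fibreAvg_comp_mul D.finite (fun x => ((‖cocycleProd r m n x‖ ^ 2 : ℝ) : ℂ) *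
    s.indicator (fun _ => (1 : ℂ)) x) (fun y => ((‖m y‖ ^ 2 : ℝ) : ℂ) * h y)
  have hI : Integrable (fun y => (((‖cocycleProd r m n (r y)‖ ^ 2 : ℝ) : ℂ) *
    s.indicator (fun _ => (1 : ℂ)) (r y)) * (((‖m y‖ ^ 2 : ℝ) : ℂ) * h y)) μ := by
    have hcr : Measurable fun y => cocycleProd r m n (r y) := hcm.comp hr
    have h1 : Measurable fun y => s.indicator (fun _ => (1 : ℂ)) (r y) :=
      (measurable_const.indicator hs).comp hr
    refine (P.integrable_weight hr (n + 1)).mono (by fun_prop) (.of_forall fun x => ?_)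
    by_cases hx : r x ∈ s
    · simp [hx, cocycleProd_succ]
      apply le_of_eq
      ring
    · simp [hx]
      positivity
  calc ∫ x, ((‖cocycleProd r m (n + 1) x‖ ^ 2 * h x : ℝ) : ℂ) *
        (r ⁻¹' s).indicator (fun _ => (1 : ℂ)) x ∂μ
      = ∫ y, (((‖cocycleProd r m n (r y)‖ ^ 2 : ℝ) : ℂ) *
          s.indicator (fun _ => (1 : ℂ)) (r y)) * (((‖m y‖ ^ 2 : ℝ) : ℂ) * h y) ∂μ := by
        congr 1
        ext x
        have : (r ⁻¹' s).indicator (fun _ => (1 : ℂ)) x = s.indicator (fun _ => 1) (r x) := rfl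
        rw [this, cocycleProd_succ, norm_mul]
        push_cast
        ring
    _ = ∫ x, (((‖cocycleProd r m n x‖ ^ 2 : ℝ) : ℂ) * s.indicator (fun _ => (1 : ℂ)) x) *
          ruelleOp r m (fun x => (h x : ℂ)) x ∂μ := by
        rw [← D.integral_fibreAvg hI, hg]
        rfl
    _ = _ := by
        apply integral_congr_ae
        filter_upwards [P.ruelle_eq] with x hx
        rw [hx]
        push_cast
        ring

/-- The path measures are the finite measures with marginals `ω_n = |m⁽ⁿ⁾|² h μ`. -/
theorem isPathMeasure_iff {ν : Measure (ProjLim r)} :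
    IsPathMeasure r μ m h ν ↔
      IsFiniteMeasure ν ∧ ∀ n, ν.map (theta r n) = marginal r μ m h n := by
  have hr := D.measurable
  have key : ∀ (n : ℕ) (f : X → ℂ), Measurable f → (∃ C : ℝ, ∀ x, ‖f x‖ ≤ C) →
      ∫ x, (ruelleOp r m)^[n] (fun y => f y * (h y : ℂ)) x ∂μ = ∫ x, f x ∂marginal r μ m h n := by
    rintro n f hf ⟨C, hC⟩
    rw [P.integral_ruelleOp_iterate D n (ξ := fun y => f y * (h y : ℂ))
      (P.integrable.ofReal.bdd_mul hf.aestronglyMeasurable (.of_forall hC)),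
      P.integral_marginal hr]
    congr 1
    ext x
    push_cast
    ring
  have hfin := P.isFiniteMeasure_marginal hr
  constructor
  · rintro ⟨h1, h2⟩
    refine ⟨h1, fun n => measure_ext_of_measureReal fun s hs => ?_⟩
    have hm : Measurable (s.indicator fun _ => (1 : ℂ)) := measurable_const.indicator hs
    have hb : ∃ C : ℝ, ∀ x, ‖s.indicator (fun _ => (1 : ℂ)) x‖ ≤ C :=
      ⟨1, fun x => by by_cases hx : x ∈ s <;> simp [hx]⟩
    have := h2 n _ hm hb
    rw [key n _ hm hb, ← integral_map (measurable_theta n).aemeasurable hm.aestronglyMeasurable,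
      integral_indicator_const _ hs, integral_indicator_const _ hs] at this
    simpa using this
  · rintro ⟨h1, h2⟩
    refine ⟨h1, fun n f hf hb => ?_⟩
    rw [key n f hf hb, ← h2 n, integral_map (measurable_theta n).aemeasurable
      hf.aestronglyMeasurable]

end IsRegularPair

end

section

/-! ### Existence of the path measure -/

open ProbabilityTheory Preorder

variable {X : Type*} {r : X → X} [MeasurableSpace X]

open Kernel in
theorem map_eval_zero_trajMeasure {μ₀ : Measure X} [IsProbabilityMeasure μ₀]
    (κ : (n : ℕ) → Kernel ((i : Finset.Iic n) → X) X) [∀ n, IsMarkovKernel (κ n)] :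
    (trajMeasure (X := fun _ => X) μ₀ κ).map (fun x => x 0) = μ₀ := by
  have h1 : (fun x : ℕ → X => x 0) =
      (fun y : (i : Finset.Iic 0) → X => y ⟨0, by simp⟩) ∘ frestrictLe (π := fun _ => X) 0 := rfl
  have h2 : (trajMeasure (X := fun _ => X) μ₀ κ).map (frestrictLe 0) =
      μ₀.map (MeasurableEquiv.piUnique (fun _ : Finset.Iic 0 => X)).symm := by
    rw [trajMeasure, Measure.map_comp _ _ (by fun_prop), traj_map_frestrictLe, partialTraj_self]
    exact Measure.id_comp
  rw [h1, ← Measure.map_map (by fun_prop) (by fun_prop), h2,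
    Measure.map_map (by fun_prop) (by fun_prop)]
  exact Measure.map_id

theorem map_prodMap_compProd_comap {S T Y : Type*} [MeasurableSpace S] [MeasurableSpace T]
    [MeasurableSpace Y] (ρ : Measure S) [IsFiniteMeasure ρ] (K : Kernel T Y) [IsMarkovKernel K]
    {g : S → T} (hg : Measurable g) :
    (ρ.compProd (K.comap g hg)).map (Prod.map g id) = (ρ.map g).compProd K := by
  ext s hs
  rw [Measure.map_apply (hg.prodMap measurable_id) hs,
    Measure.compProd_apply (hg.prodMap measurable_id hs), Measure.compProd_apply hs,
    lintegral_map (Kernel.measurable_kernel_prodMk_left hs) hg]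
  rfl

/-- A consistent sequence of probability measures on a standard Borel space extends to the
projective limit: the conditional laws of `y` given `r(y)` under the given measures are the
transition kernels of a Markov chain (Ionescu-Tulcea), which almost surely runs backwards
along `r`. -/
theorem exists_probabilityMeasure_projLim [StandardBorelSpace X] (hr : Measurable r)
    (ω : ℕ → Measure X) [∀ n, IsProbabilityMeasure (ω n)]
    (hω : ∀ n, (ω (n + 1)).map r = ω n) :
    ∃ ν : Measure (ProjLim r), IsFiniteMeasure ν ∧ ∀ n, ν.map (theta r n) = ω n := by
  have : Nonempty X := (ω 0).nonempty_of_neZero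
  let J : ℕ → Measure (X × X) := fun n => (ω (n + 1)).map fun y => (r y, y)
  have hJm : Measurable fun y => (r y, y) := hr.prodMk measurable_id
  have hJ : ∀ n, IsProbabilityMeasure (J n) := fun n =>
    Measure.isProbabilityMeasure_map hJm.aemeasurable
  have hJfst : ∀ n, (J n).fst = ω n := fun n => by
    rw [Measure.fst, Measure.map_map measurable_fst hJm]
    exact hω n
  have hev : ∀ n : ℕ, Measurable fun x : (i : Finset.Iic n) → X => x ⟨n, by simp⟩ := fun n => by
    fun_prop
  let κ : (n : ℕ) → Kernel ((i : Finset.Iic n) → X) X := fun n => (J n).condKernel.comap _ (hev n)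
  have hκ : ∀ n, IsMarkovKernel (κ n) := fun n => by dsimp only [κ]; infer_instance
  let Q : Measure (ℕ → X) := Kernel.trajMeasure (X := fun _ => X) (ω 0) κ
  have hQp : IsProbabilityMeasure Q := by dsimp only [Q]; infer_instance
  have hstep : ∀ n, Q.map (fun x => x n) = ω n → Q.map (fun x => (x n, x (n + 1))) = J n := by
    intro n hn
    have h1 := Kernel.map_frestrictLe_trajMeasure_compProd_eq_map_trajMeasure
      (X := fun _ => X) (μ₀ := ω 0) (κ := κ) (a := n)
    have h2 := congrArg (fun ρ => ρ.map (Prod.map (fun x : (i : Finset.Iic n) → X =>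
      x ⟨n, by simp⟩) (id : X → X))) h1
    have hfin : IsFiniteMeasure (Q.map (frestrictLe (π := fun _ => X) n)) := by infer_instance
    rw [map_prodMap_compProd_comap, Measure.map_map (by fun_prop) (by fun_prop),
      Measure.map_map ((hev n).prodMap measurable_id) (by fun_prop)] at h2
    have h3 : Q.map ((fun x : (i : Finset.Iic n) → X => x ⟨n, by simp⟩) ∘
        frestrictLe (π := fun _ => X) n) = (J n).fst := by
      rw [hJfst]; exact hn
    rw [h3, (J n).disintegrate] at h2
    exact h2.symm
  have hmarg : ∀ n, Q.map (fun x => x n) = ω n := by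
    intro n
    induction n with
    | zero => exact map_eval_zero_trajMeasure κ
    | succ n ih =>
      have h1 := congrArg (fun ρ => ρ.map Prod.snd) (hstep n ih)
      rw [Measure.map_map measurable_snd (by fun_prop), Measure.map_map measurable_snd hJm] at h1
      exact h1.trans Measure.map_id
  let G : Set (ℕ → X) := {x | ∀ n, r (x (n + 1)) = x n}
  have hJG : MeasurableSet {p : X × X | r p.2 = p.1} :=
    measurableSet_eq_fun (hr.comp measurable_snd) measurable_fst
  have hG : MeasurableSet G := by
    have : G = ⋂ n, (fun x : ℕ → X => (x n, x (n + 1))) ⁻¹' {p : X × X | r p.2 = p.1} := by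
      ext x; simp [G]
    rw [this]
    exact MeasurableSet.iInter fun n => hJG.preimage (by fun_prop)
  have hQG : ∀ᵐ x ∂Q, x ∈ G := by
    refine ae_all_iff.2 fun n => ?_
    have h1 : ∀ᵐ p ∂J n, r p.2 = p.1 := by
      rw [ae_map_iff hJm.aemeasurable hJG]
      exact .of_forall fun _ => rfl
    rw [← hstep n (hmarg n), ae_map_iff (by fun_prop) hJG] at h1
    exact h1
  have hemb : MeasurableEmbedding (Subtype.val : ProjLim r → ℕ → X) := .subtype_coe hG
  have hmap : (Q.comap (Subtype.val : ProjLim r → ℕ → X)).map Subtype.val = Q := by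
    rw [hemb.map_comap]
    apply Measure.restrict_eq_self_of_ae_mem
    filter_upwards [hQG] with x hx
    exact ⟨⟨x, hx⟩, rfl⟩
  refine ⟨Q.comap Subtype.val, ?_, fun n => ?_⟩
  · refine ⟨?_⟩
    rw [hemb.comap_apply]
    exact measure_lt_top _ _
  · rw [← hmarg n]
    conv_rhs => rw [← hmap]
    rw [Measure.map_map (by fun_prop) measurable_subtype_coe]
    rfl

theorem exists_measure_projLim [StandardBorelSpace X] (hr : Measurable r)
    (ω : ℕ → Measure X) [∀ n, IsFiniteMeasure (ω n)]
    (hω : ∀ n, (ω (n + 1)).map r = ω n) :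
    ∃ ν : Measure (ProjLim r), IsFiniteMeasure ν ∧ ∀ n, ν.map (theta r n) = ω n := by
  have hmass : ∀ n, ω n Set.univ = ω 0 Set.univ := by
    intro n
    induction n with
    | zero => rfl
    | succ n ih => rw [← ih, ← hω n, Measure.map_apply hr .univ, Set.preimage_univ]
  by_cases h0 : ω 0 Set.univ = 0
  · refine ⟨0, inferInstance, fun n => ?_⟩
    rw [Measure.map_zero, eq_comm, ← Measure.measure_univ_eq_zero, hmass, h0]
  · have hp : ∀ n, IsProbabilityMeasure ((ω 0 Set.univ)⁻¹ • ω n) := fun n => ⟨by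
      rw [Measure.smul_apply, hmass n, smul_eq_mul, ENNReal.inv_mul_cancel h0 (measure_ne_top _ _)]⟩
    obtain ⟨ν, h1, h2⟩ := exists_probabilityMeasure_projLim hr (fun n => (ω 0 Set.univ)⁻¹ • ω n)
      fun n => by rw [Measure.map_smul, hω]
    refine ⟨ω 0 Set.univ • ν, Measure.smul_finite _ (measure_ne_top _ _), fun n => ?_⟩
    rw [Measure.map_smul, h2, smul_smul, ENNReal.mul_inv_cancel h0 (measure_ne_top _ _), one_smul]

theorem IsRegularPair.exists_isPathMeasure [StandardBorelSpace X] {μ : Measure X}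
    [IsProbabilityMeasure μ] {m : X → ℂ} {h : X → ℝ} (P : IsRegularPair r μ m h)
    (D : IsDynamics r μ) : ∃ ν, IsPathMeasure r μ m h ν := by
  have := P.isFiniteMeasure_marginal D.measurable
  obtain ⟨ν, hν⟩ := exists_measure_projLim D.measurable _ (P.map_marginal_succ D)
  exact ⟨ν, (P.isPathMeasure_iff D).2 hν⟩

end

section

/-! ### The covariant system attached to a path measure -/

theorem toL2_congr {Ω : Type*} [MeasurableSpace Ω] {ν : Measure Ω} {F G : Ω → ℂ}
    (hFG : F =ᵐ[ν] G) : toL2 ν F = toL2 ν G := by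
  by_cases hF : MemLp F 2 ν
  · rw [toL2, toL2, dif_pos hF, dif_pos ((memLp_congr_ae hFG).1 hF)]
    exact (MemLp.toLp_eq_toLp_iff _ _).2 hFG
  · rw [toL2, toL2, dif_neg hF, dif_neg fun h => hF ((memLp_congr_ae hFG).2 h)]

theorem coeFn_toL2 {Ω : Type*} [MeasurableSpace Ω] {ν : Measure Ω} {F : Ω → ℂ}
    (hF : MemLp F 2 ν) : toL2 ν F =ᵐ[ν] F := by
  rw [toL2, dif_pos hF]
  exact hF.coeFn_toLp

theorem exists_ae_norm_le {Ω : Type*} [MeasurableSpace Ω] {ν : Measure Ω} {f : Ω → ℂ}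
    (hf : MemLp f ∞ ν) : ∃ C : ℝ, ∀ᵐ x ∂ν, ‖f x‖ ≤ C := by
  refine ⟨(eLpNorm f ∞ ν).toReal, ?_⟩
  filter_upwards [ae_le_eLpNormEssSup (f := f) (μ := ν)] with x hx
  rw [← eLpNorm_exponent_top, ← ofReal_norm] at hx
  exact (ENNReal.ofReal_le_iff_le_toReal hf.2.ne).1 hx

variable {X : Type*} {r : X → X} [MeasurableSpace X] {μ : Measure X}
  {m : X → ℂ} {h : X → ℝ} {ν : Measure (ProjLim r)}

/-- A regular Perron–Ruelle–Frobenius pair over the dynamics `(r, μ)` together with its path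
measure, described by its marginals. -/
structure IsCovariantSystem (r : X → X) (μ : Measure X) (m : X → ℂ) (h : X → ℝ)
    (ν : Measure (ProjLim r)) : Prop where
  dynamics : IsDynamics r μ
  pair : IsRegularPair r μ m h
  finite : IsFiniteMeasure ν
  map_theta : ∀ n, ν.map (theta r n) = marginal r μ m h n

namespace IsCovariantSystem

variable (V : IsCovariantSystem r μ m h ν)
include V

theorem lintegral_theta (n : ℕ) {f : X → ℝ≥0∞} (hf : Measurable f) :
    ∫⁻ x, f (theta r n x) ∂ν = ∫⁻ x, marginalWeight r m h n x * f x ∂μ := by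
  rw [← lintegral_map hf (measurable_theta n), V.map_theta, marginal,
    lintegral_withDensity_eq_lintegral_mul _
      (V.pair.measurable_marginalWeight V.dynamics.measurable n) hf]
  rfl

theorem integral_theta (n : ℕ) {f : X → ℂ} (hf : Measurable f) :
    ∫ x, f (theta r n x) ∂ν = ∫ x, ((‖cocycleProd r m n x‖ ^ 2 * h x : ℝ) : ℂ) * f x ∂μ := by
  rw [← V.pair.integral_marginal V.dynamics.measurable, ← V.map_theta,
    integral_map (measurable_theta n).aemeasurable hf.aestronglyMeasurable]

theorem quasiMeasurePreserving_theta (n : ℕ) :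
    Measure.QuasiMeasurePreserving (theta r n) ν μ :=
  ⟨measurable_theta n, by rw [V.map_theta]; exact withDensity_absolutelyContinuous _ _⟩

theorem integral_theta_zero {f : X → ℂ} (hf : AEStronglyMeasurable f μ) :
    ∫ x, f (theta r 0 x) ∂ν = ∫ x, f x * h x ∂μ := by
  obtain ⟨g, hg, hfg⟩ := hf.aemeasurable
  have hfg' : (fun x => f (theta r 0 x)) =ᵐ[ν] fun x => g (theta r 0 x) :=
    (V.quasiMeasurePreserving_theta 0).ae_eq_comp hfg
  rw [integral_congr_ae hfg',
    integral_congr_ae (hfg.mono fun x hx => by rw [hx])]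
  refine (V.integral_theta 0 hg).trans (integral_congr_ae (.of_forall fun x => ?_))
  simp [mul_comm]

/-- The measure `|m ∘ θ₀|² ν` is carried to `ν` by the shift `r̂`. -/
theorem map_rHat :
    (ν.withDensity fun x => ‖m (theta r 0 x)‖ₑ ^ 2).map (rHat r) = ν := by
  have hr := V.dynamics.measurable
  have hm := V.pair.measurable
  have := V.finite
  symm
  refine ProjLim.ext_of_theta hr fun n E hE => ?_
  have hmn : Measurable fun x => m (r^[n] x) := hm.comp (hr.iterate n)
  have hpre : rHat r ⁻¹' (theta r (n + 1) ⁻¹' E) = theta r n ⁻¹' E := rfl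
  rw [Measure.map_apply (measurable_rHat hr) (measurable_theta _ hE), hpre,
    withDensity_apply _ (measurable_theta n hE), ← lintegral_indicator (measurable_theta n hE)]
  have e1 : ∀ x, (theta r n ⁻¹' E).indicator (fun x => ‖m (theta r 0 x)‖ₑ ^ 2) x =
      E.indicator (fun y => ‖m (r^[n] y)‖ₑ ^ 2) (theta r n x) := fun x => by
    by_cases hx : theta r n x ∈ E <;> simp [hx, iterate_theta_zero]
  have e2 : ν (theta r (n + 1) ⁻¹' E) = marginal r μ m h (n + 1) E := by
    rw [← V.map_theta, Measure.map_apply (measurable_theta _) hE]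
  simp only [e1]
  rw [V.lintegral_theta n ((hmn.enorm.pow_const 2).indicator hE), e2, marginal,
    withDensity_apply _ hE, ← lintegral_indicator hE]
  congr 1
  ext x
  by_cases hx : x ∈ E
  · simp only [hx, Set.indicator_of_mem, marginalWeight, cocycleProd_succ', enorm_mul]
    ring
  · simp [hx]

theorem measurable_weight : Measurable fun x => ‖m (theta r 0 x)‖ₑ ^ 2 :=
  (V.pair.measurable.comp (measurable_theta 0)).enorm.pow_const 2

theorem lintegral_comp_rHat {F : ProjLim r → ℝ≥0∞} (hF : AEMeasurable F ν) :
    ∫⁻ x, ‖m (theta r 0 x)‖ₑ ^ 2 * F (rHat r x) ∂ν = ∫⁻ x, F x ∂ν := by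
  have hrm := measurable_rHat V.dynamics.measurable
  conv_rhs => rw [← V.map_rHat]
  rw [lintegral_map' (by rwa [V.map_rHat]) hrm.aemeasurable,
    lintegral_withDensity_eq_lintegral_mul₀' V.measurable_weight.aemeasurable]
  · rfl
  · have : AEMeasurable F ((ν.withDensity fun x => ‖m (theta r 0 x)‖ₑ ^ 2).map (rHat r)) := by
      rwa [V.map_rHat]
    exact this.comp_measurable hrm

theorem integral_comp_rHat {F : ProjLim r → ℂ} (hF : AEStronglyMeasurable F ν) :
    ∫ x, ((‖m (theta r 0 x)‖ ^ 2 : ℝ) : ℂ) * F (rHat r x) ∂ν = ∫ x, F x ∂ν := by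
  have hrm := measurable_rHat V.dynamics.measurable
  conv_rhs => rw [← V.map_rHat]
  rw [integral_map hrm.aemeasurable (by rwa [V.map_rHat]),
    integral_withDensity_eq_integral_toReal_smul V.measurable_weight
      (.of_forall fun x => by simp)]
  simp [Complex.real_smul]

theorem quasiMeasurePreserving_rHat : Measure.QuasiMeasurePreserving (rHat r) ν ν := by
  have hrm := measurable_rHat V.dynamics.measurable
  refine ⟨hrm, Measure.AbsolutelyContinuous.mk fun s hs h0 => ?_⟩
  rw [Measure.map_apply hrm hs]
  have h1 := V.lintegral_comp_rHat (F := s.indicator 1) (measurable_const.indicator hs).aemeasurable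
  rw [lintegral_indicator_one hs, h0] at h1
  replace h1 := (lintegral_eq_zero_iff (V.measurable_weight.mul
    ((measurable_const.indicator hs).comp hrm))).1 h1
  rw [measure_eq_zero_iff_ae_notMem]
  filter_upwards [h1] with x hx hxs
  have : rHat r x ∈ s := hxs
  simp [this, V.pair.ne_zero] at hx

theorem eLpNorm_covU {ξ : ProjLim r → ℂ} (hξ : AEStronglyMeasurable ξ ν) :
    eLpNorm (fun x => m (theta r 0 x) * ξ (rHat r x)) 2 ν = eLpNorm ξ 2 ν := by
  rw [eLpNorm_eq_lintegral_rpow_enorm_toReal (by simp) (by simp),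
    eLpNorm_eq_lintegral_rpow_enorm_toReal (by simp) (by simp)]
  congr 1
  simp only [ENNReal.toReal_ofNat, ENNReal.rpow_ofNat, enorm_mul, mul_pow]
  exact V.lintegral_comp_rHat (hξ.enorm.pow_const 2)

theorem memLp_covU {ξ : ProjLim r → ℂ} (hξ : MemLp ξ 2 ν) :
    MemLp (fun x => m (theta r 0 x) * ξ (rHat r x)) 2 ν := by
  refine ⟨?_, by rw [V.eLpNorm_covU hξ.1]; exact hξ.2⟩
  exact (V.pair.measurable.comp (measurable_theta 0)).aestronglyMeasurable.mul
    (hξ.1.comp_quasiMeasurePreserving V.quasiMeasurePreserving_rHat)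

theorem coeFn_covU (ξ : Lp ℂ 2 ν) :
    covU r m ν ξ =ᵐ[ν] fun x => m (theta r 0 x) * ξ (rHat r x) :=
  coeFn_toL2 (V.memLp_covU (Lp.memLp ξ))

/-- `U` is isometric, hence injective. -/
theorem covU_injective : Function.Injective (covU r m ν) := by
  intro ξ η hξη
  have h1 : (fun x => m (theta r 0 x) * (ξ - η : Lp ℂ 2 ν) (rHat r x)) =ᵐ[ν] 0 := by
    have h2 := V.coeFn_covU ξ
    rw [hξη] at h2
    filter_upwards [h2, V.coeFn_covU η,
      V.quasiMeasurePreserving_rHat.ae_eq_comp (Lp.coeFn_sub ξ η)] with x h3 h4 h5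
    simp only [Function.comp_apply, Pi.sub_apply] at h5
    rw [h5, mul_sub, ← h3, ← h4, sub_self]
    rfl
  have h2 := V.eLpNorm_covU (Lp.aestronglyMeasurable (ξ - η))
  rw [eLpNorm_congr_ae h1, eLpNorm_zero, eq_comm,
    eLpNorm_eq_zero_iff (Lp.aestronglyMeasurable _) (by simp)] at h2
  exact sub_eq_zero.1 ((Lp.eq_zero_iff_ae_eq_zero).2 h2)

theorem memLp_top_comp_theta (n : ℕ) {g : X → ℂ} (hg : MemLp g ∞ μ) :
    MemLp (fun x => g (theta r n x)) ∞ ν := by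
  have hq := V.quasiMeasurePreserving_theta n
  obtain ⟨C, hC⟩ := exists_ae_norm_le hg
  exact memLp_top_of_bound (hg.1.comp_quasiMeasurePreserving hq) C (hq.ae hC)

theorem memLp_covPi {g : X → ℂ} (hg : MemLp g ∞ μ) {ξ : ProjLim r → ℂ} (hξ : MemLp ξ 2 ν) :
    MemLp (fun x => g (theta r 0 x) * ξ x) 2 ν :=
  hξ.mul (V.memLp_top_comp_theta 0 hg)

theorem coeFn_covPi {g : X → ℂ} (hg : MemLp g ∞ μ) (ξ : Lp ℂ 2 ν) :
    covPi r ν g ξ =ᵐ[ν] fun x => g (theta r 0 x) * ξ x :=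
  coeFn_toL2 (V.memLp_covPi hg (Lp.memLp ξ))

theorem coeFn_covPhi : covPhi r ν =ᵐ[ν] fun _ => 1 := by
  have := V.finite
  exact coeFn_toL2 (memLp_const 1)

end IsCovariantSystem

end

section

/-! ### Multiplication operators between two `L²` spaces -/

variable {Ω : Type*} [mΩ : MeasurableSpace Ω] {ν ν' : Measure Ω} {f : Ω → ℂ}

/-- Multiplication by the measurable function `f` is bounded from `L²(ν)` to `L²(ν')`: the measure
`|f|² ν'` is at most a multiple of `ν`. -/
structure IsDominated (ν ν' : Measure Ω) (f : Ω → ℂ) : Prop where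
  measurable : Measurable f
  le : ∃ C : ℝ≥0, ν'.withDensity (fun x => ‖f x‖ₑ ^ 2) ≤ C • ν

/-- An inequality between finite measures on a generating algebra of sets extends to the
generated `σ`-algebra, since every measurable set is approximated by sets of the algebra. -/
theorem measure_le_of_isSetAlgebra {ρ₁ ρ₂ : Measure Ω} [IsFiniteMeasure ρ₁] [IsFiniteMeasure ρ₂]
    {𝒜 : Set (Set Ω)} (h𝒜 : IsSetAlgebra 𝒜) (hgen : mΩ = MeasurableSpace.generateFrom 𝒜)
    (hle : ∀ s ∈ 𝒜, ρ₁ s ≤ ρ₂ s) : ρ₁ ≤ ρ₂ := by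
  have hd := Measure.MeasureDense.of_generateFrom_isSetAlgebra_finite (ρ₁ + ρ₂) h𝒜 hgen
  refine Measure.le_iff.2 fun s hs => ENNReal.le_of_forall_pos_le_add fun ε hε _ => ?_
  obtain ⟨t, ht, hst⟩ := hd.approx s hs (measure_ne_top _ _) ε (by exact_mod_cast hε)
  rw [ENNReal.ofReal_coe_nnreal, Measure.add_apply] at hst
  have h1 : ρ₁ s ≤ ρ₁ t + ρ₁ (s ∆ t) := by
    refine (measure_mono fun x hx => ?_).trans (measure_union_le _ _)
    by_cases hxt : x ∈ t
    · exact .inl hxt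
    · exact .inr (.inl ⟨hx, hxt⟩)
  have h2 : ρ₂ t ≤ ρ₂ s + ρ₂ (s ∆ t) := by
    refine (measure_mono fun x hx => ?_).trans (measure_union_le _ _)
    by_cases hxs : x ∈ s
    · exact .inl hxs
    · exact .inr (.inr ⟨hx, hxs⟩)
  calc ρ₁ s ≤ ρ₁ t + ρ₁ (s ∆ t) := h1
    _ ≤ ρ₂ s + ρ₂ (s ∆ t) + ρ₁ (s ∆ t) := by gcongr; exact (hle t ht).trans h2
    _ = ρ₂ s + (ρ₁ (s ∆ t) + ρ₂ (s ∆ t)) := by rw [add_assoc, add_comm (ρ₂ (s ∆ t))]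
    _ ≤ ρ₂ s + ε := by gcongr

theorem IsDominated.eq_zero_on (hf : IsDominated ν ν' f) {S : Set Ω} (hS : MeasurableSet S)
    (hS0 : ν S = 0) :
    ∀ᵐ x ∂ν', x ∈ S → f x = 0 := by
  obtain ⟨C, hC⟩ := hf.le
  have h1 : ∫⁻ x in S, ‖f x‖ₑ ^ 2 ∂ν' = 0 := by
    rw [← withDensity_apply _ hS]
    refine le_antisymm ((Measure.le_iff.1 hC S hS).trans ?_) zero_le
    simp [hS0]
  rw [lintegral_eq_zero_iff (hf.measurable.enorm.pow_const 2), EventuallyEq,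
    ae_restrict_iff' hS] at h1
  filter_upwards [h1] with x hx hxS
  simpa using hx hxS

theorem enorm_mul_sqrt_density [IsFiniteMeasure ν'] {S : Set Ω} :
    ∀ᵐ x ∂ν, ‖f x * (Real.sqrt (density ν ν' S x) : ℂ)‖ₑ ^ 2 =
      (ν'.restrict Sᶜ).rnDeriv ν x * ‖f x‖ₑ ^ 2 := by
  filter_upwards [Measure.rnDeriv_lt_top (ν'.restrict Sᶜ) ν] with x hx
  have h1 : ‖(Real.sqrt (density ν ν' S x) : ℂ)‖ₑ ^ 2 = (ν'.restrict Sᶜ).rnDeriv ν x := by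
    rw [← ofReal_norm, Complex.norm_real, Real.norm_of_nonneg (Real.sqrt_nonneg _),
      ← ENNReal.ofReal_pow (Real.sqrt_nonneg _),
      Real.sq_sqrt (show 0 ≤ density ν ν' S x from ENNReal.toReal_nonneg)]
    exact ENNReal.ofReal_toReal hx.ne
  rw [enorm_mul, mul_pow, h1, mul_comm]

section Density

variable [IsFiniteMeasure ν] [IsFiniteMeasure ν'] {S : Set Ω}

theorem setLIntegral_rnDeriv_mul (hac : ν'.restrict Sᶜ ≪ ν) {F : Ω → ℝ≥0∞}
    (hF : Measurable F) {E : Set Ω} (hE : MeasurableSet E) :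
    ∫⁻ x in E, (ν'.restrict Sᶜ).rnDeriv ν x * F x ∂ν = ∫⁻ x in E, F x ∂(ν'.restrict Sᶜ) := by
  conv_rhs => rw [← Measure.withDensity_rnDeriv_eq _ _ hac]
  rw [restrict_withDensity hE,
    lintegral_withDensity_eq_lintegral_mul _ (Measure.measurable_rnDeriv _ _) hF]
  rfl

theorem isDominated_of_bounded (hS : MeasurableSet S) (hac : ν'.restrict Sᶜ ≪ ν)
    (hf : Measurable f) (hfS : ∀ x ∈ S, f x = 0)
    (hb : ∃ C : ℝ, ∀ᵐ x ∂ν, ‖f x * (Real.sqrt (density ν ν' S x) : ℂ)‖ ≤ C) :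
    IsDominated ν ν' f := by
  obtain ⟨C, hC⟩ := hb
  refine ⟨hf, C.toNNReal ^ 2, Measure.le_iff.2 fun E hE => ?_⟩
  have hm : Measurable fun x => ‖f x‖ₑ ^ 2 := hf.enorm.pow_const 2
  have h0 : ∫⁻ x in E, ‖f x‖ₑ ^ 2 ∂(ν'.restrict S) = 0 := by
    refine le_antisymm ((setLIntegral_le_lintegral _ _).trans ?_) zero_le
    rw [setLIntegral_congr_fun hS (g := fun _ => 0) fun x hx => by simp [hfS x hx]]
    simp
  rw [withDensity_apply _ hE, ← Measure.restrict_add_restrict_compl (μ := ν') hS,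
    Measure.restrict_add, lintegral_add_measure, h0, zero_add,
    ← setLIntegral_rnDeriv_mul hac hm hE, Measure.smul_apply]
  calc ∫⁻ x in E, (ν'.restrict Sᶜ).rnDeriv ν x * ‖f x‖ₑ ^ 2 ∂ν
      ≤ ∫⁻ _ in E, (C.toNNReal : ℝ≥0∞) ^ 2 ∂ν := by
        apply lintegral_mono_ae
        filter_upwards [ae_restrict_of_ae hC,
          ae_restrict_of_ae (enorm_mul_sqrt_density (f := f) (ν := ν) (ν' := ν') (S := S))]
          with x hx hx'
        rw [← hx', ← ofReal_norm]
        gcongr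
        exact ENNReal.ofReal_le_ofReal hx
    _ = _ := by
        rw [setLIntegral_const]
        simp [ENNReal.smul_def]

theorem IsDominated.bounded (hf : IsDominated ν ν' f) (hac : ν'.restrict Sᶜ ≪ ν) :
    ∃ C : ℝ, ∀ᵐ x ∂ν, ‖f x * (Real.sqrt (density ν ν' S x) : ℂ)‖ ≤ C := by
  obtain ⟨C, hC⟩ := hf.le
  have hm : Measurable fun x => ‖f x‖ₑ ^ 2 := hf.measurable.enorm.pow_const 2
  have h1 : (fun x => (ν'.restrict Sᶜ).rnDeriv ν x * ‖f x‖ₑ ^ 2) ≤ᵐ[ν] fun _ => (C : ℝ≥0∞) := by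
    refine ae_le_of_forall_setLIntegral_le_of_sigmaFinite
      ((Measure.measurable_rnDeriv _ _).mul hm) fun E hE _ => ?_
    rw [setLIntegral_rnDeriv_mul hac hm hE, setLIntegral_const]
    calc ∫⁻ x in E, ‖f x‖ₑ ^ 2 ∂(ν'.restrict Sᶜ) ≤ ∫⁻ x in E, ‖f x‖ₑ ^ 2 ∂ν' :=
          lintegral_mono' (Measure.restrict_mono le_rfl Measure.restrict_le_self) le_rfl
      _ = ν'.withDensity (fun x => ‖f x‖ₑ ^ 2) E := (withDensity_apply _ hE).symm
      _ ≤ (C • ν) E := Measure.le_iff.1 hC E hE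
      _ = _ := by rw [Measure.smul_apply, ENNReal.smul_def, smul_eq_mul]
  refine ⟨Real.sqrt C, ?_⟩
  filter_upwards [h1, enorm_mul_sqrt_density (f := f) (ν := ν) (ν' := ν') (S := S)] with x hx hx'
  rw [← hx', ← ofReal_norm, ← ENNReal.ofReal_pow (norm_nonneg _),
    ENNReal.ofReal_le_iff_le_toReal ENNReal.coe_ne_top] at hx
  exact Real.le_sqrt_of_sq_le hx

theorem integral_mul_density (hac : ν'.restrict Sᶜ ≪ ν)
    (hfS : ∀ x ∈ S, f x = 0) (F : Ω → ℂ) :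
    ∫ x, F x * (f x * (density ν ν' S x : ℂ)) ∂ν = ∫ x, F x * f x ∂ν' := by
  calc ∫ x, F x * (f x * (density ν ν' S x : ℂ)) ∂ν
      = ∫ x, ((ν'.restrict Sᶜ).rnDeriv ν x).toReal • (F x * f x) ∂ν := by
        congr 1
        ext x
        rw [Complex.real_smul, density]
        ring
    _ = ∫ x, F x * f x ∂(ν'.restrict Sᶜ) := integral_rnDeriv_smul hac
    _ = ∫ x, F x * f x ∂ν' := by
        refine setIntegral_eq_integral_of_forall_compl_eq_zero fun x hx => ?_
        rw [hfS x (by simpa using hx), mul_zero]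

theorem integrable_mul_density (hac : ν'.restrict Sᶜ ≪ ν) (hf : Integrable f ν') :
    Integrable (fun x => f x * (density ν ν' S x : ℂ)) ν := by
  have := (integrable_rnDeriv_smul_iff hac).2 (hf.restrict (s := Sᶜ))
  refine this.congr (.of_forall fun x => ?_)
  simp [Complex.real_smul, density, mul_comm]

end Density

namespace IsDominated

variable (hf : IsDominated ν ν' f)
include hf

theorem ae_of_ae {p : Ω → Prop} (hp : ∀ᵐ x ∂ν, p x) : ∀ᵐ x ∂ν', f x ≠ 0 → p x := by
  obtain ⟨C, hC⟩ := hf.le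
  have h1 : ν'.withDensity (fun x => ‖f x‖ₑ ^ 2) ≪ ν :=
    (Measure.absolutelyContinuous_of_le hC).trans Measure.smul_absolutelyContinuous
  have h2 : ∀ᵐ x ∂ν'.withDensity (fun x => ‖f x‖ₑ ^ 2), p x := h1.ae_le hp
  rw [ae_withDensity_iff (hf.measurable.enorm.pow_const 2)] at h2
  filter_upwards [h2] with x hx hfx
  exact hx (by simpa using hfx)

theorem mul_congr {ξ η : Ω → ℂ} (h : ξ =ᵐ[ν] η) :
    (fun x => f x * ξ x) =ᵐ[ν'] fun x => f x * η x := by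
  filter_upwards [hf.ae_of_ae h] with x hx
  by_cases h0 : f x = 0
  · simp [h0]
  · rw [hx h0]

/-- The bound `‖f ξ‖ ≤ √C ‖ξ‖` between the `L²`-seminorms. -/
theorem exists_eLpNorm_le : ∃ C : ℝ≥0, ∀ ξ : Ω → ℂ, MemLp ξ 2 ν →
    MemLp (fun x => f x * ξ x) 2 ν' ∧ eLpNorm (fun x => f x * ξ x) 2 ν' ≤ C * eLpNorm ξ 2 ν := by
  obtain ⟨C, hC⟩ := hf.le
  refine ⟨NNReal.sqrt C, fun ξ hξ => ?_⟩
  obtain ⟨η, hη, hξη⟩ := hξ.1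
  have hη' := hη.measurable
  have hc := hf.mul_congr hξη
  have hm : AEStronglyMeasurable (fun x => f x * ξ x) ν' :=
    (hf.measurable.mul hη').aestronglyMeasurable.congr hc.symm
  have hle : eLpNorm (fun x => f x * ξ x) 2 ν' ≤ (NNReal.sqrt C : ℝ≥0∞) * eLpNorm ξ 2 ν := by
    rw [eLpNorm_congr_ae hc, eLpNorm_congr_ae hξη,
      eLpNorm_eq_lintegral_rpow_enorm_toReal (by simp) (by simp),
      eLpNorm_eq_lintegral_rpow_enorm_toReal (by simp) (by simp)]
    simp only [ENNReal.toReal_ofNat, ENNReal.rpow_ofNat, enorm_mul, mul_pow]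
    have h1 : ∫⁻ x, ‖f x‖ₑ ^ 2 * ‖η x‖ₑ ^ 2 ∂ν' ≤ C * ∫⁻ x, ‖η x‖ₑ ^ 2 ∂ν := by
      have := lintegral_withDensity_eq_lintegral_mul ν' (hf.measurable.enorm.pow_const 2)
        (hη'.enorm.pow_const 2)
      simp only [Pi.mul_apply] at this
      rw [← this]
      calc _ ≤ ∫⁻ x, ‖η x‖ₑ ^ 2 ∂(C • ν) := lintegral_mono' hC le_rfl
        _ = _ := by rw [lintegral_smul_measure]; rfl
    have h2 : (NNReal.sqrt C : ℝ≥0∞) = (C : ℝ≥0∞) ^ (1 / 2 : ℝ) := by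
      rw [NNReal.sqrt_eq_rpow, ENNReal.coe_rpow_of_nonneg _ (by norm_num)]
    rw [h2, ← ENNReal.mul_rpow_of_nonneg _ _ (by norm_num)]
    gcongr
  exact ⟨⟨hm, hle.trans_lt (ENNReal.mul_lt_top ENNReal.coe_lt_top hξ.2)⟩, hle⟩

theorem memLp_mul {ξ : Ω → ℂ} (hξ : MemLp ξ 2 ν) : MemLp (fun x => f x * ξ x) 2 ν' :=
  (hf.exists_eLpNorm_le.choose_spec ξ hξ).1

theorem memLp [IsFiniteMeasure ν] : MemLp f 2 ν' := by
  simpa using hf.memLp_mul (memLp_const 1)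

/-- The multiplication operator `M_f : L²(ν) → L²(ν')`. -/
theorem exists_mulOperator : ∃ A : Lp ℂ 2 ν →L[ℂ] Lp ℂ 2 ν',
    ∀ ξ : Lp ℂ 2 ν, A ξ =ᵐ[ν'] fun x => f x * ξ x := by
  obtain ⟨C, hC⟩ := hf.exists_eLpNorm_le
  let T : Lp ℂ 2 ν →ₗ[ℂ] Lp ℂ 2 ν' :=
    { toFun := fun ξ => (hf.memLp_mul (Lp.memLp ξ)).toLp
      map_add' := fun ξ η => by
        rw [← MemLp.toLp_add, MemLp.toLp_eq_toLp_iff]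
        filter_upwards [hf.mul_congr (Lp.coeFn_add ξ η)] with x hx
        exact hx.trans (mul_add _ _ _)
      map_smul' := fun c ξ => by
        rw [RingHom.id_apply, ← MemLp.toLp_const_smul, MemLp.toLp_eq_toLp_iff]
        filter_upwards [hf.mul_congr (Lp.coeFn_smul c ξ)] with x hx
        simp only [hx, Pi.smul_apply, smul_eq_mul]
        ring }
  refine ⟨T.mkContinuous C fun ξ => ?_, fun ξ => (hf.memLp_mul (Lp.memLp ξ)).coeFn_toLp⟩
  change ‖(hf.memLp_mul (Lp.memLp ξ)).toLp‖ ≤ _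
  rw [Lp.norm_toLp, Lp.norm_def, ← ENNReal.coe_toReal, ← ENNReal.toReal_mul]
  exact ENNReal.toReal_mono (ENNReal.mul_ne_top ENNReal.coe_ne_top (Lp.eLpNorm_ne_top _))
    (hC ξ (Lp.memLp ξ)).2

end IsDominated

/-- An operator `L²(ν) → L²(ν')` that commutes with the indicators of a generating algebra of
sets, when applied to `1`, is a multiplication operator. Its multiplier is the image of `1`. -/
theorem exists_isDominated_of_commute [IsFiniteMeasure ν] [IsFiniteMeasure ν'] {𝒜 : Set (Set Ω)}
    (h𝒜 : IsSetAlgebra 𝒜) (hgen : mΩ = MeasurableSpace.generateFrom 𝒜)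
    (A : Lp ℂ 2 ν →L[ℂ] Lp ℂ 2 ν')
    (hA : ∀ E ∈ 𝒜, ∀ ξ η : Lp ℂ 2 ν, ξ =ᵐ[ν] 1 → η =ᵐ[ν] E.indicator 1 →
      A η =ᵐ[ν'] E.indicator (A ξ)) :
    ∃ f, IsDominated ν ν' f ∧ ∀ ξ, A ξ =ᵐ[ν'] fun x => f x * ξ x := by
  let one : Lp ℂ 2 ν := (memLp_const (1 : ℂ)).toLp
  have hone : one =ᵐ[ν] 1 := MemLp.coeFn_toLp _
  let f : Ω → ℂ := A one
  have hfm : Measurable f := (Lp.stronglyMeasurable _).measurable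
  have hd := Measure.MeasureDense.of_generateFrom_isSetAlgebra_finite ν h𝒜 hgen
  have hAE : ∀ E (hE : E ∈ 𝒜), A (indicatorConstLp 2 (hd.measurable E hE) (measure_ne_top ν E) 1)
      =ᵐ[ν'] E.indicator f := fun E hE => hA E hE one _ hone indicatorConstLp_coeFn
  have hfin : IsFiniteMeasure (ν'.withDensity fun x => ‖f x‖ₑ ^ 2) := by
    refine isFiniteMeasure_withDensity ?_
    have := (Lp.memLp (A one)).2
    rw [eLpNorm_lt_top_iff_lintegral_rpow_enorm_lt_top (by simp) (by simp)] at this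
    simpa using this.ne
  have hfd : IsDominated ν ν' f := by
    refine ⟨hfm, ‖A‖₊ ^ 2, measure_le_of_isSetAlgebra h𝒜 hgen fun E hE => ?_⟩
    have hEm := hd.measurable E hE
    have h1 := A.le_opENorm (indicatorConstLp 2 hEm (measure_ne_top ν E) 1)
    have h2 : ∫⁻ x, ‖A (indicatorConstLp 2 hEm (measure_ne_top ν E) 1) x‖ₑ ^ 2 ∂ν' =
        ν'.withDensity (fun x => ‖f x‖ₑ ^ 2) E := by
      rw [withDensity_apply _ hEm, ← lintegral_indicator hEm]
      apply lintegral_congr_ae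
      filter_upwards [hAE E hE] with x hx
      rw [hx]
      by_cases hxE : x ∈ E <;> simp [hxE]
    have h3 : ∀ (ρ : Measure Ω) (ξ : Lp ℂ 2 ρ), (‖ξ‖ₑ : ℝ≥0∞) ^ 2 = ∫⁻ x, ‖ξ x‖ₑ ^ 2 ∂ρ := by
      intro ρ ξ
      rw [Lp.enorm_def, eLpNorm_eq_lintegral_rpow_enorm_toReal (by simp) (by simp),
        ← ENNReal.rpow_natCast, ← ENNReal.rpow_mul]
      simp
    have h4 : (‖(indicatorConstLp 2 hEm (measure_ne_top ν E) (1 : ℂ) : Lp ℂ 2 ν)‖ₑ : ℝ≥0∞) ^ 2 =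
        ν E := by
      rw [h3, ← lintegral_indicator_one hEm]
      apply lintegral_congr_ae
      filter_upwards [indicatorConstLp_coeFn (p := 2) (hs := hEm) (hμs := measure_ne_top ν E)
        (c := (1 : ℂ))] with x hx
      rw [hx]
      by_cases hxE : x ∈ E <;> simp [hxE]
    rw [← h2, ← h3, Measure.smul_apply, ← h4, ENNReal.smul_def, smul_eq_mul, ENNReal.coe_pow,
      ← mul_pow]
    gcongr
    exact h1
  obtain ⟨B, hB⟩ := hfd.exists_mulOperator
  refine ⟨f, hfd, ?_⟩
  suffices A = B by
    intro ξ
    rw [this]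
    exact hB ξ
  have hcl : IsClosed {ξ : Lp ℂ 2 ν | A ξ = B ξ} := isClosed_eq A.continuous B.continuous
  have : Fact ((2 : ℝ≥0∞) ≠ ∞) := ⟨by simp⟩
  have hind : ∀ (s : Set Ω) (hs : MeasurableSet s),
      indicatorConstLp 2 hs (measure_ne_top ν s) (1 : ℂ) ∈ {ξ : Lp ℂ 2 ν | A ξ = B ξ} := by
    intro s hs
    refine closure_minimal ?_ hcl (hd.indicatorConstLp_subset_closure 2 (1 : ℂ)
      ⟨s, hs, measure_ne_top ν s, rfl⟩)
    rintro _ ⟨t, ht, htν, rfl⟩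
    refine Lp.ext ((hAE t ht).trans ((?_ : _ =ᵐ[ν'] _).trans (hB _).symm))
    filter_upwards [hfd.mul_congr (indicatorConstLp_coeFn (p := 2) (hs := hd.measurable t ht)
      (hμs := htν) (c := (1 : ℂ)))] with x hx
    rw [hx]
    by_cases hxt : x ∈ t <;> simp [hxt]
  ext1 ξ
  refine Lp.induction (p := 2) (by simp) (fun ξ => A ξ = B ξ) ?_ ?_ hcl ξ
  · intro c s hs hμs
    have h1 := hind _ hs
    have h2 : (Lp.simpleFunc.indicatorConst 2 hs hμs.ne c : Lp ℂ 2 ν) =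
        c • indicatorConstLp 2 hs (measure_ne_top ν _) (1 : ℂ) := by
      rw [Lp.simpleFunc.coe_indicatorConst]
      apply Lp.ext
      filter_upwards [indicatorConstLp_coeFn (p := 2) (hs := hs) (hμs := hμs.ne) (c := c),
        Lp.coeFn_smul c (indicatorConstLp 2 hs (measure_ne_top ν _) (1 : ℂ)),
        indicatorConstLp_coeFn (p := 2) (hs := hs) (hμs := measure_ne_top ν _) (c := (1 : ℂ))]
        with x hx1 hx2 hx3
      rw [hx1, hx2, Pi.smul_apply, hx3, ← Set.indicator_const_smul_apply]
      simp
    rw [h2, map_smul, map_smul, show A _ = B _ from h1]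
  · intro f g hf hg _ h1 h2
    rw [map_add, map_add, h1, h2]

end

section

variable {X : Type*} {r : X → X} [MeasurableSpace X] {μ : Measure X}
  {m m' : X → ℂ} {h h' : X → ℝ} {ν ν' : Measure (ProjLim r)} {S : Set (ProjLim r)}

/-! ### Intertwining operators are multiplication operators -/

/-- An intertwiner commutes with multiplication by functions of any coordinate `x_n`, because
`U (g ∘ θ_{n+1}) = (g ∘ θ_n) U` and `U'` is injective. -/
theorem intertwiner_comp_theta (V : IsCovariantSystem r μ m h ν)
    (V' : IsCovariantSystem r μ m' h' ν') {A : Lp ℂ 2 ν →L[ℂ] Lp ℂ 2 ν'}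
    (hA : A ∈ intertwiners r μ m m' ν ν') {g : X → ℂ} (hg : MemLp g ∞ μ) (n : ℕ) :
    ∀ ξ η : Lp ℂ 2 ν, η =ᵐ[ν] (fun x => g (theta r n x) * ξ x) →
      A η =ᵐ[ν'] fun x => g (theta r n x) * A ξ x := by
  induction n with
  | zero =>
    intro ξ η hη
    have e : η = covPi r ν g ξ := Lp.ext (hη.trans (V.coeFn_covPi hg ξ).symm)
    rw [e, ← hA.2 g hg ξ]
    exact V'.coeFn_covPi hg (A ξ)
  | succ n ih =>
    intro ξ η hη
    have h1 : covU r m ν η =ᵐ[ν] fun x => g (theta r n x) * covU r m ν ξ x := by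
      filter_upwards [V.coeFn_covU η, V.coeFn_covU ξ,
        V.quasiMeasurePreserving_rHat.ae hη] with x hx1 hx2 hx3
      rw [hx1, hx2, hx3, theta_succ_rHat]
      ring
    have h2 := ih _ _ h1
    rw [← hA.1, ← hA.1] at h2
    have hmem : MemLp (fun x => g (theta r (n + 1) x) * A ξ x) 2 ν' :=
      (Lp.memLp (A ξ)).mul (V'.memLp_top_comp_theta (n + 1) hg)
    have h3 : covU r m' ν' (A η) = covU r m' ν' hmem.toLp := by
      apply Lp.ext
      filter_upwards [h2, V'.coeFn_covU (A ξ), V'.coeFn_covU hmem.toLp,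
        V'.quasiMeasurePreserving_rHat.ae hmem.coeFn_toLp] with x hx1 hx2 hx3 hx4
      rw [hx1, hx2, hx3, hx4, theta_succ_rHat]
      ring
    rw [V'.covU_injective h3]
    exact hmem.coeFn_toLp

/-- A dominated function that satisfies the cocycle equation agrees with a multiplier: it vanishes
almost everywhere on the singular part, so it may be set to `0` there. -/
theorem IsDominated.exists_isMultiplier [IsFiniteMeasure ν]
    (V' : IsCovariantSystem r μ m' h' ν') (hS : MeasurableSet S) (hS0 : ν S = 0)
    (hac : ν'.restrict Sᶜ ≪ ν) {f : ProjLim r → ℂ} (hf : IsDominated ν ν' f)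
    (hc : ∀ᵐ x ∂ν', m (theta r 0 x) * f x = m' (theta r 0 x) * f (rHat r x)) :
    ∃ k, IsMultiplier r m m' ν ν' S k ∧ k =ᵐ[ν'] f := by
  have := V'.finite
  have hff : Sᶜ.indicator f =ᵐ[ν'] f := by
    filter_upwards [hf.eq_zero_on hS hS0] with x hx
    by_cases hxS : x ∈ S <;> simp [hxS, hx]
  have hf' : IsDominated ν ν' (Sᶜ.indicator f) := by
    refine ⟨hf.measurable.indicator hS.compl, ?_⟩
    rw [withDensity_congr_ae (g := fun x => ‖f x‖ₑ ^ 2) (hff.mono fun x hx => by simp [hx])]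
    exact hf.le
  refine ⟨Sᶜ.indicator f, ⟨hf'.measurable, fun x hx => by simp [hx], hf'.bounded hac, ?_⟩, hff⟩
  filter_upwards [hc, hff, V'.quasiMeasurePreserving_rHat.ae hff] with x hx1 hx2 hx3
  rw [hx2, hx3, hx1]

theorem exists_isMultiplier_of_intertwiner (V : IsCovariantSystem r μ m h ν)
    (V' : IsCovariantSystem r μ m' h' ν') (hS : MeasurableSet S) (hS0 : ν S = 0)
    (hac : ν'.restrict Sᶜ ≪ ν) {A : Lp ℂ 2 ν →L[ℂ] Lp ℂ 2 ν'}
    (hA : A ∈ intertwiners r μ m m' ν ν') :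
    ∃ f, IsMultiplier r m m' ν ν' S f ∧ ∀ ξ : Lp ℂ 2 ν, A ξ =ᵐ[ν'] fun x => f x * ξ x := by
  have := V.finite
  have := V'.finite
  have hr := V.dynamics.measurable
  have hcomm : ∀ E ∈ cylinders r, ∀ ξ η : Lp ℂ 2 ν, ξ =ᵐ[ν] 1 → η =ᵐ[ν] E.indicator 1 →
      A η =ᵐ[ν'] E.indicator (A ξ) := by
    rintro _ ⟨n, B, hB, rfl⟩ ξ η hξ hη
    have hg : MemLp (B.indicator fun _ => (1 : ℂ)) ∞ μ := (memLp_top_const 1).indicator hB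
    have e : ∀ F : ProjLim r → ℂ, (theta r n ⁻¹' B).indicator F =
        fun x => B.indicator (fun _ => (1 : ℂ)) (theta r n x) * F x := fun F => by
      ext x
      by_cases hx : theta r n x ∈ B <;> simp [hx]
    rw [e]
    refine intertwiner_comp_theta V V' hA hg n ξ η ?_
    filter_upwards [hξ, hη] with x hx1 hx2
    rw [hx1, hx2, e]
  obtain ⟨f, hf, hAf⟩ := exists_isDominated_of_commute (isSetAlgebra_cylinders hr)
    generateFrom_cylinders A hcomm
  have hcoc : ∀ᵐ x ∂ν', m (theta r 0 x) * f x = m' (theta r 0 x) * f (rHat r x) := by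
    -- The cocycle equation is the intertwining relation applied to the vector `φ = 1`.
    have h1 := V.coeFn_covPhi
    have h2 : A (covPhi r ν) =ᵐ[ν'] f := by
      filter_upwards [hAf (covPhi r ν), hf.ae_of_ae h1] with x hx1 hx2
      rw [hx1]
      by_cases h0 : f x = 0
      · simp [h0]
      · rw [hx2 h0, mul_one]
    have h3 := hAf (covU r m ν (covPhi r ν))
    rw [← hA.1] at h3
    filter_upwards [h3, V'.coeFn_covU (A (covPhi r ν)), V'.quasiMeasurePreserving_rHat.ae h2,
      hf.ae_of_ae (V.coeFn_covU (covPhi r ν)),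
      hf.ae_of_ae (V.quasiMeasurePreserving_rHat.ae h1)] with x hx1 hx2 hx3 hx4 hx5
    rw [← hx3, ← hx2, hx1]
    by_cases h0 : f x = 0
    · simp [h0]
    · rw [hx4 h0, hx5 h0]
      ring
  obtain ⟨k, hk, hkf⟩ := hf.exists_isMultiplier V' hS hS0 hac hcoc
  exact ⟨k, hk, fun ξ => (hAf ξ).trans (hkf.mono fun x hx => by simp [hx])⟩

theorem IsMultiplier.isDominated [IsFiniteMeasure ν] [IsFiniteMeasure ν'] {f : ProjLim r → ℂ}
    (hf : IsMultiplier r m m' ν ν' S f) (hS : MeasurableSet S) (hac : ν'.restrict Sᶜ ≪ ν) :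
    IsDominated ν ν' f :=
  isDominated_of_bounded hS hac hf.measurable hf.eq_zero hf.bounded

/-- Conversely, multiplication by a solution of the cocycle equation intertwines. -/
theorem IsMultiplier.exists_intertwiner (V : IsCovariantSystem r μ m h ν)
    (V' : IsCovariantSystem r μ m' h' ν') (hS : MeasurableSet S) (hac : ν'.restrict Sᶜ ≪ ν)
    {f : ProjLim r → ℂ} (hf : IsMultiplier r m m' ν ν' S f) :
    ∃ A ∈ intertwiners r μ m m' ν ν', ∀ ξ : Lp ℂ 2 ν, A ξ =ᵐ[ν'] fun x => f x * ξ x := by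
  have := V.finite
  have := V'.finite
  have hd := hf.isDominated hS hac
  obtain ⟨A, hA⟩ := hd.exists_mulOperator
  refine ⟨A, ⟨fun ξ => Lp.ext ?_, fun g hg ξ => Lp.ext ?_⟩, hA⟩
  · filter_upwards [V'.coeFn_covU (A ξ), hA (covU r m ν ξ), hd.mul_congr (V.coeFn_covU ξ),
      V'.quasiMeasurePreserving_rHat.ae (hA ξ), hf.cocycle] with x hx1 hx2 hx3 hx4 hx5
    rw [hx1, hx2, hx3, hx4, ← mul_assoc, ← hx5]
    ring
  · filter_upwards [V'.coeFn_covPi hg (A ξ), hA (covPi r ν g ξ), hd.mul_congr (V.coeFn_covPi hg ξ),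
      hA ξ] with x hx1 hx2 hx3 hx4
    rw [hx1, hx2, hx3, hx4]
    ring

/-! ### From multipliers to harmonic functions -/

theorem measurable_condE₀ (ν : Measure (ProjLim r)) (f : ProjLim r → ℂ) :
    Measurable (condE₀ r ν f) :=
  (exists_condExp_eq_comp r ν f).choose_spec.1

theorem condE₀_comp_theta (ν : Measure (ProjLim r)) (f : ProjLim r → ℂ) :
    (fun x => condE₀ r ν f (theta r 0 x)) =
      ν[f | MeasurableSpace.comap (theta r 0) inferInstance] :=
  (exists_condExp_eq_comp r ν f).choose_spec.2.symm

theorem IsCovariantSystem.integrable_condE₀_mul (V : IsCovariantSystem r μ m h ν)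
    (f : ProjLim r → ℂ) : Integrable (fun x => condE₀ r ν f x * (h x : ℂ)) μ := by
  have h1 : Integrable (condE₀ r ν f ∘ theta r 0) ν := by
    have : condE₀ r ν f ∘ theta r 0 = _ := condE₀_comp_theta ν f
    rw [this]
    exact integrable_condExp
  rw [← integrable_map_measure (measurable_condE₀ ν f).aestronglyMeasurable
    (measurable_theta 0).aemeasurable, V.map_theta, marginal,
    integrable_withDensity_iff_integrable_smul'
      (V.pair.measurable_marginalWeight V.dynamics.measurable 0)
      (.of_forall fun x => by simp [marginalWeight])] at h1
  refine h1.congr (.of_forall fun x => ?_)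
  simp [V.pair.toReal_marginalWeight, mul_comm]

/-- `E₀(f) h` is the density with respect to `μ` of the image of `f ν` under `θ₀`. -/
theorem IsCovariantSystem.integral_mul_condE₀ (V : IsCovariantSystem r μ m h ν)
    {f : ProjLim r → ℂ} (hf : Integrable f ν) {g : X → ℂ} (hg : MemLp g ∞ μ) :
    ∫ x, g (theta r 0 x) * f x ∂ν = ∫ x, g x * (condE₀ r ν f x * (h x : ℂ)) ∂μ := by
  have := V.finite
  obtain ⟨k, hk, hgk⟩ := hg.1.aemeasurable
  have hkb := hg.ae_eq hgk
  have hgk' : ∀ᵐ x ∂ν, g (theta r 0 x) = k (theta r 0 x) :=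
    (V.quasiMeasurePreserving_theta 0).ae hgk
  rw [integral_congr_ae (hgk'.mono fun x hx => by rw [hx]),
    integral_congr_ae (hgk.mono fun x hx => by rw [hx])]
  have hle : MeasurableSpace.comap (theta r 0) inferInstance ≤
      (inferInstance : MeasurableSpace (ProjLim r)) := (measurable_theta 0).comap_le
  have hkm : StronglyMeasurable[MeasurableSpace.comap (theta r 0) inferInstance]
      fun x => k (theta r 0 x) :=
    (hk.comp (comap_measurable (theta r 0))).stronglyMeasurable
  have hi : Integrable (fun x => k (theta r 0 x) * f x) ν := by
    obtain ⟨C, hC⟩ := exists_ae_norm_le hkb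
    exact hf.bdd_mul (hk.comp (measurable_theta 0)).aestronglyMeasurable
      ((V.quasiMeasurePreserving_theta 0).ae hC)
  have h1 := condExp_bilin_of_stronglyMeasurable_left (ContinuousLinearMap.mul ℝ ℂ) hkm hi hf
  simp only [ContinuousLinearMap.mul_apply'] at h1
  rw [← integral_condExp hle, integral_congr_ae h1, ← condE₀_comp_theta]
  rw [V.integral_theta_zero (f := fun x => k x * condE₀ r ν f x)
    (hk.mul (measurable_condE₀ ν f)).aestronglyMeasurable]
  simp only [mul_assoc]

theorem ae_eq_of_integral_indicator_mul {k l : X → ℂ} (hk : Integrable k μ) (hl : Integrable l μ)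
    (hkl : ∀ s, MeasurableSet s → ∫ x, s.indicator (fun _ => (1 : ℂ)) x * k x ∂μ =
      ∫ x, s.indicator (fun _ => (1 : ℂ)) x * l x ∂μ) : k =ᵐ[μ] l := by
  refine Integrable.ae_eq_of_forall_setIntegral_eq k l hk hl fun s hs _ => ?_
  have e : ∀ F : X → ℂ, ∫ x in s, F x ∂μ = ∫ x, s.indicator (fun _ => (1 : ℂ)) x * F x ∂μ := by
    intro F
    rw [← integral_indicator hs]
    congr 1
    ext x
    by_cases hx : x ∈ s <;> simp [hx]
  rw [e, e, hkl s hs]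

theorem memLp_top_indicator {s : Set X} (hs : MeasurableSet s) :
    MemLp (s.indicator fun _ => (1 : ℂ)) ∞ μ :=
  (memLp_top_const 1).indicator hs

theorem IsMultiplier.integrable (V : IsCovariantSystem r μ m h ν)
    (V' : IsCovariantSystem r μ m' h' ν') (hS : MeasurableSet S) (hac : ν'.restrict Sᶜ ≪ ν)
    {f : ProjLim r → ℂ} (hf : IsMultiplier r m m' ν ν' S f) : Integrable f ν' := by
  have := V.finite
  have := V'.finite
  exact (hf.isDominated hS hac).memLp.integrable (by norm_num)

/-- The two expressions `E₀^{ν'}(f) h'` and `E₀^ν(f Δ) h` agree. -/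
theorem IsMultiplier.condE₀_mul_eq (V : IsCovariantSystem r μ m h ν)
    (V' : IsCovariantSystem r μ m' h' ν') (hS : MeasurableSet S) (hac : ν'.restrict Sᶜ ≪ ν)
    {f : ProjLim r → ℂ} (hf : IsMultiplier r m m' ν ν' S f) :
    (fun x => condE₀ r ν' f x * (h' x : ℂ)) =ᵐ[μ]
      fun x => condE₀ r ν (fun y => f y * (density ν ν' S y : ℂ)) x * (h x : ℂ) := by
  have := V.finite
  have := V'.finite
  have hi := hf.integrable V V' hS hac
  refine ae_eq_of_integral_indicator_mul (V'.integrable_condE₀_mul f)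
    (V.integrable_condE₀_mul _) fun s hs => ?_
  rw [← V'.integral_mul_condE₀ hi (memLp_top_indicator hs),
    ← V.integral_mul_condE₀ (integrable_mul_density hac hi) (memLp_top_indicator hs),
    integral_mul_density hac hf.eq_zero]

/-- The function `E₀(f) h'` is fixed by the mixed Ruelle operator: this is the cocycle equation
for `f`, integrated along the fibres of `θ₀` with the help of `d(ν' ∘ r̂)/dν' = |m'|²`. -/
theorem mixedRuelleOp_condE₀_mul [IsProbabilityMeasure μ] (V' : IsCovariantSystem r μ m' h' ν')
    (hm : Measurable m) (hmb : ∃ C : ℝ, ∀ x, ‖m x‖ ≤ C)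
    {f : ProjLim r → ℂ} (hi : Integrable f ν')
    (hf : ∀ᵐ x ∂ν', m (theta r 0 x) * f x = m' (theta r 0 x) * f (rHat r x)) :
    mixedRuelleOp r m m' (fun x => condE₀ r ν' f x * (h' x : ℂ)) =ᵐ[μ]
      fun x => condE₀ r ν' f x * (h' x : ℂ) := by
  have D := V'.dynamics
  obtain ⟨C, hC⟩ := hmb
  obtain ⟨C', hC'⟩ := V'.pair.bounded
  have hI := V'.integrable_condE₀_mul f
  have hm' := V'.pair.measurable
  have hcm : Measurable fun y => conj (m' y) * m y := by fun_prop
  have hcb : ∀ y, ‖conj (m' y) * m y‖ ≤ C' * C := fun y => by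
    rw [norm_mul, RCLike.norm_conj]
    exact mul_le_mul (hC' y) (hC y) (norm_nonneg _) ((norm_nonneg _).trans (hC' y))
  have hI2 : Integrable (fun y => conj (m' y) * m y * (condE₀ r ν' f y * (h' y : ℂ))) μ :=
    hI.bdd_mul hcm.aestronglyMeasurable (.of_forall hcb)
  refine ae_eq_of_integral_indicator_mul (D.integrable_fibreAvg hI2) hI fun s hs => ?_
  have hsr : Measurable fun y => s.indicator (fun _ => (1 : ℂ)) (r y) :=
    (measurable_const.indicator hs).comp D.measurable
  have hsb : ∀ y, ‖s.indicator (fun _ => (1 : ℂ)) (r y)‖ ≤ 1 := fun y => by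
    by_cases hy : r y ∈ s <;> simp [hy]
  have hg : MemLp (fun y => s.indicator (fun _ => (1 : ℂ)) (r y) * (conj (m' y) * m y)) ∞ μ := by
    refine memLp_top_of_bound (hsr.mul hcm).aestronglyMeasurable (1 * (C' * C))
      (.of_forall fun y => ?_)
    rw [norm_mul]
    exact mul_le_mul (hsb y) (hcb y) (norm_nonneg _) zero_le_one
  calc ∫ x, s.indicator (fun _ => (1 : ℂ)) x *
        mixedRuelleOp r m m' (fun x => condE₀ r ν' f x * (h' x : ℂ)) x ∂μ
      = ∫ x, fibreAvg r (fun y => s.indicator (fun _ => (1 : ℂ)) (r y) *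
          (conj (m' y) * m y * (condE₀ r ν' f y * (h' y : ℂ)))) x ∂μ := by
        rw [fibreAvg_comp_mul D.finite]
        rfl
    _ = ∫ y, (s.indicator (fun _ => (1 : ℂ)) (r y) * (conj (m' y) * m y)) *
          (condE₀ r ν' f y * (h' y : ℂ)) ∂μ := by
        rw [D.integral_fibreAvg (hI2.bdd_mul hsr.aestronglyMeasurable (.of_forall hsb))]
        simp only [mul_assoc]
    _ = ∫ x, (s.indicator (fun _ => (1 : ℂ)) (r (theta r 0 x)) *
          (conj (m' (theta r 0 x)) * m (theta r 0 x))) * f x ∂ν' :=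
        (V'.integral_mul_condE₀ hi hg).symm
    _ = ∫ x, ((‖m' (theta r 0 x)‖ ^ 2 : ℝ) : ℂ) *
          (s.indicator (fun _ => (1 : ℂ)) (theta r 0 (rHat r x)) * f (rHat r x)) ∂ν' := by
        apply integral_congr_ae
        filter_upwards [hf] with x hx
        have e : ((‖m' (theta r 0 x)‖ ^ 2 : ℝ) : ℂ) =
            conj (m' (theta r 0 x)) * m' (theta r 0 x) := by
          rw [Complex.conj_mul', Complex.ofReal_pow]
        rw [e, theta_zero_rHat]
        linear_combination (s.indicator (fun _ => (1 : ℂ)) (r (theta r 0 x)) *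
          conj (m' (theta r 0 x))) * hx
    _ = ∫ x, s.indicator (fun _ => (1 : ℂ)) (theta r 0 x) * f x ∂ν' :=
        V'.integral_comp_rHat (F := fun x => s.indicator (fun _ => (1 : ℂ)) (theta r 0 x) * f x)
          (((measurable_const.indicator hs).comp (measurable_theta 0)).aestronglyMeasurable.mul
            hi.1)
    _ = _ := V'.integral_mul_condE₀ hi (memLp_top_indicator hs)

/-- A function that satisfies the cocycle equation is determined by its conditional expectation
onto functions of `x₀`, since the equation gives its conditional expectations onto functions of
`x_n` recursively. -/
theorem ae_eq_zero_of_cocycle (V' : IsCovariantSystem r μ m' h' ν')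
    (hm : Measurable m) (hmb : ∃ C : ℝ, ∀ x, ‖m x‖ ≤ C)
    {f : ProjLim r → ℂ} (hi : Integrable f ν')
    (hf : ∀ᵐ x ∂ν', m (theta r 0 x) * f x = m' (theta r 0 x) * f (rHat r x))
    (h0 : ∀ g : X → ℂ, Measurable g → (∃ C : ℝ, ∀ x, ‖g x‖ ≤ C) →
      ∫ x, g (theta r 0 x) * f x ∂ν' = 0) : f =ᵐ[ν'] 0 := by
  have D := V'.dynamics
  obtain ⟨C, hC⟩ := hmb
  obtain ⟨C', hC'⟩ := V'.pair.bounded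
  have hm' := V'.pair.measurable
  have hn : ∀ n : ℕ, ∀ g : X → ℂ, Measurable g → (∃ C : ℝ, ∀ x, ‖g x‖ ≤ C) →
      ∫ x, g (theta r n x) * f x ∂ν' = 0 := by
    intro n
    induction n with
    | zero => exact h0
    | succ n ih =>
      rintro g hg ⟨K, hK⟩
      have hcm : Measurable fun y => conj (m' (r^[n] y)) * m (r^[n] y) * g y := by
        have h1 := hm.comp (D.measurable.iterate n)
        have h2 := hm'.comp (D.measurable.iterate n)
        exact ((Complex.continuous_conj.measurable.comp h2).mul h1).mul hg
      rw [← ih _ hcm ⟨C' * C * K, fun y => ?_⟩,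
        ← V'.integral_comp_rHat (F := fun x => g (theta r (n + 1) x) * f x)
          ((hg.comp (measurable_theta _)).aestronglyMeasurable.mul hi.1)]
      · apply integral_congr_ae
        filter_upwards [hf] with x hx
        have e : ((‖m' (theta r 0 x)‖ ^ 2 : ℝ) : ℂ) =
            conj (m' (theta r 0 x)) * m' (theta r 0 x) := by
          rw [Complex.conj_mul', Complex.ofReal_pow]
        simp only [theta_succ_rHat, iterate_theta_zero, e]
        linear_combination (-conj (m' (theta r 0 x)) * g (theta r n x)) * hx
      · rw [norm_mul, norm_mul, RCLike.norm_conj]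
        gcongr
        · exact mul_nonneg ((norm_nonneg _).trans (hC' y)) ((norm_nonneg _).trans (hC y))
        · exact (norm_nonneg _).trans (hC' y)
        · exact hC' _
        · exact hC _
        · exact hK y
  have hset : ∀ s, MeasurableSet s → ∫ x in s, f x ∂ν' = 0 := by
    intro s hs
    induction s, hs using MeasurableSpace.induction_on_inter generateFrom_cylinders
      (isPiSystem_cylinders D.measurable) with
    | empty => simp
    | basic t ht =>
      obtain ⟨n, E, hE, rfl⟩ := ht
      rw [← integral_indicator (measurable_theta n hE),
        ← hn n (E.indicator fun _ => 1) (measurable_const.indicator hE)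
          ⟨1, fun x => by by_cases hx : x ∈ E <;> simp [hx]⟩]
      congr 1
      ext x
      by_cases hx : theta r n x ∈ E <;> simp [hx]
    | compl t ht iht =>
      have h1 := integral_add_compl ht hi
      have h2 := hn 0 (fun _ => 1) measurable_const ⟨1, by simp⟩
      simp only [one_mul] at h2
      rwa [iht, zero_add, h2] at h1
    | iUnion t hd ht iht =>
      rw [integral_iUnion ht hd hi.integrableOn]
      simp [iht]
  exact Integrable.ae_eq_of_forall_setIntegral_eq f 0 hi (integrable_zero _ _ _)
    fun s hs _ => by simpa using hset s hs

theorem IsCovariantSystem.measureReal_theta_zero_preimage (V : IsCovariantSystem r μ m h ν)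
    {s : Set X}
    (hs : MeasurableSet s) : ν.real (theta r 0 ⁻¹' s) = ∫ x in s, h x ∂μ := by
  rw [← map_measureReal_apply (measurable_theta 0) hs, V.map_theta, marginal, Measure.real,
    withDensity_apply _ hs, integral_eq_lintegral_of_nonneg_ae (.of_forall V.pair.nonneg)
      V.pair.measurable_h.aestronglyMeasurable]
  simp [marginalWeight]

/-- The inequality `|h₀|² ≤ C h h'` is obtained by optimizing over `t` the inequalities
`2 t |h₀| ≤ t² h' + C h`, which hold because they integrate `2 t |f| ≤ t² + |f|²`. -/
theorem norm_condE₀_mul_sq_le (V : IsCovariantSystem r μ m h ν)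
    (V' : IsCovariantSystem r μ m' h' ν') {f : ProjLim r → ℂ} (hf : IsDominated ν ν' f) :
    ∃ c : ℝ, 0 ≤ c ∧ ∀ᵐ x ∂μ, ‖condE₀ r ν' f x * (h' x : ℂ)‖ ^ 2 ≤ c * h x * h' x := by
  have := V.finite
  have := V'.finite
  have hfL := hf.memLp
  have hi : Integrable f ν' := hfL.integrable (by norm_num)
  obtain ⟨C, hC⟩ := hf.le
  set k : X → ℂ := fun x => condE₀ r ν' f x * (h' x : ℂ) with hk
  have hkm : Measurable k := by
    have := measurable_condE₀ ν' f
    have := V'.pair.measurable_h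
    fun_prop
  have hki : Integrable k μ := V'.integrable_condE₀_mul f
  have key : ∀ t : ℝ, 0 < t → ∀ᵐ x ∂μ, 2 * t * ‖k x‖ ≤ t ^ 2 * h' x + C * h x := by
    intro t ht
    refine ae_le_of_forall_setIntegral_le (hki.norm.const_mul _)
      ((V'.pair.integrable.const_mul _).add (V.pair.integrable.const_mul _)) fun s hs _ => ?_
    -- `g` is a phase: `g k = |k|` on `s`, with the value `0 / 0 = 0` where `k` vanishes.
    let g : X → ℂ := s.indicator fun x => conj (k x) / ‖k x‖
    have hgm : Measurable g := by
      refine Measurable.indicator ?_ hs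
      fun_prop
    have hgb : ∀ x, ‖g x‖ ≤ s.indicator (fun _ => (1 : ℝ)) x := fun x => by
      by_cases hx : x ∈ s
      · simpa [g, hx] using div_self_le_one ‖k x‖
      · simp [g, hx]
    have hgb1 : ∀ x, ‖g x‖ ≤ 1 := fun x => (hgb x).trans
      (Set.indicator_le_self' (fun _ _ => zero_le_one) x)
    have hgk : ∀ x, g x * k x = s.indicator (fun x => (‖k x‖ : ℂ)) x := fun x => by
      by_cases hx : x ∈ s
      · by_cases h0 : k x = 0
        · simp [g, hx, h0]
        · have : (‖k x‖ : ℂ) ≠ 0 := by simpa using h0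
          simp only [g, hx, Set.indicator_of_mem]
          rw [div_mul_eq_mul_div, Complex.conj_mul', sq, mul_div_assoc, div_self this, mul_one]
      · simp [g, hx]
    have e1 : ((∫ x in s, ‖k x‖ ∂μ : ℝ) : ℂ) = ∫ x, g (theta r 0 x) * f x ∂ν' := by
      rw [V'.integral_mul_condE₀ hi (memLp_top_of_bound hgm.aestronglyMeasurable 1
        (.of_forall hgb1)), ← integral_complex_ofReal, ← integral_indicator hs]
      simp only [← hgk]
      rfl
    have hsθ := measurable_theta (r := r) 0 hs
    have hf2 : Integrable (fun x => ‖f x‖ ^ 2) ν' := hfL.integrable_norm_pow (by norm_num)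
    have e2 : ∫ x in s, ‖k x‖ ∂μ ≤ ∫ x in theta r 0 ⁻¹' s, ‖f x‖ ∂ν' := by
      calc ∫ x in s, ‖k x‖ ∂μ ≤ ‖((∫ x in s, ‖k x‖ ∂μ : ℝ) : ℂ)‖ := by
            rw [Complex.norm_real]; exact le_abs_self _
        _ ≤ ∫ x, ‖g (theta r 0 x) * f x‖ ∂ν' := by rw [e1]; exact norm_integral_le_integral_norm _
        _ ≤ ∫ x, (theta r 0 ⁻¹' s).indicator (fun x => ‖f x‖) x ∂ν' := by
            refine integral_mono_of_nonneg (.of_forall fun _ => norm_nonneg _)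
              (hi.norm.indicator hsθ) (.of_forall fun x => ?_)
            have := hgb (theta r 0 x)
            simp only [norm_mul]
            by_cases hx : theta r 0 x ∈ s
            · simp only [hx, Set.indicator_of_mem] at this
              simpa [hx] using mul_le_mul_of_nonneg_right this (norm_nonneg (f x))
            · simp only [hx, Set.indicator_of_notMem, not_false_eq_true, norm_le_zero_iff] at this
              simp [hx, this]
        _ = _ := integral_indicator hsθ
    have e3 : ∫ x in theta r 0 ⁻¹' s, ‖f x‖ ^ 2 ∂ν' ≤ C * ν.real (theta r 0 ⁻¹' s) := by
      rw [integral_eq_lintegral_of_nonneg_ae (.of_forall fun _ => by positivity)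
        hf2.1.restrict]
      have h1 := Measure.le_iff.1 hC _ hsθ
      rw [withDensity_apply _ hsθ, Measure.smul_apply, ENNReal.smul_def, smul_eq_mul] at h1
      have h2 := ENNReal.toReal_mono (ENNReal.mul_ne_top ENNReal.coe_ne_top (measure_ne_top _ _)) h1
      rw [ENNReal.toReal_mul, ENNReal.coe_toReal] at h2
      refine le_trans (le_of_eq ?_) h2
      congr 2
      ext x
      rw [ENNReal.ofReal_pow (norm_nonneg _), ofReal_norm]
    calc ∫ x in s, 2 * t * ‖k x‖ ∂μ = 2 * t * ∫ x in s, ‖k x‖ ∂μ := integral_const_mul _ _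
      _ ≤ 2 * t * ∫ x in theta r 0 ⁻¹' s, ‖f x‖ ∂ν' := by gcongr
      _ = ∫ x in theta r 0 ⁻¹' s, 2 * t * ‖f x‖ ∂ν' := (integral_const_mul _ _).symm
      _ ≤ ∫ x in theta r 0 ⁻¹' s, (t ^ 2 + ‖f x‖ ^ 2) ∂ν' := by
          refine integral_mono (hi.norm.const_mul _).restrict
            ((integrable_const _).add hf2).restrict fun x => ?_
          dsimp only
          nlinarith [sq_nonneg (t - ‖f x‖)]
      _ = t ^ 2 * ν'.real (theta r 0 ⁻¹' s) + ∫ x in theta r 0 ⁻¹' s, ‖f x‖ ^ 2 ∂ν' := by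
          rw [integral_add (integrable_const _).restrict hf2.restrict, setIntegral_const,
            smul_eq_mul, mul_comm]
      _ ≤ t ^ 2 * ν'.real (theta r 0 ⁻¹' s) + C * ν.real (theta r 0 ⁻¹' s) := by gcongr
      _ = ∫ x in s, (t ^ 2 * h' x + C * h x) ∂μ := by
          rw [V.measureReal_theta_zero_preimage hs,
            V'.measureReal_theta_zero_preimage hs, integral_add
            (V'.pair.integrable.const_mul _).restrict (V.pair.integrable.const_mul _).restrict,
            integral_const_mul, integral_const_mul]
  refine ⟨C, C.2, ?_⟩
  have hall : ∀ᵐ x ∂μ, ∀ q : ℚ, 0 < q → 2 * (q : ℝ) * ‖k x‖ ≤ (q : ℝ) ^ 2 * h' x + C * h x :=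
    ae_all_iff.2 fun q => by
      by_cases hq : 0 < q
      · filter_upwards [key q (by exact_mod_cast hq)] with x hx _ using hx
      · exact .of_forall fun x hx => absurd hx hq
  filter_upwards [hall] with x hx
  have hh := V.pair.nonneg x
  have hh' := V'.pair.nonneg x
  have hC0 : (0 : ℝ) ≤ C := C.2
  have hreal : ∀ t : ℝ, 0 ≤ h' x * (t * t) + (-(2 * ‖k x‖)) * t + C * h x := by
    intro t
    refine Rat.denseRange_cast.induction_on (p := fun t : ℝ =>
      0 ≤ h' x * (t * t) + (-(2 * ‖k x‖)) * t + C * h x) t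
      (isClosed_le continuous_const (by fun_prop)) fun q => ?_
    rcases lt_or_ge 0 q with hq | hq
    · linarith [hx q hq]
    · have hq' : (q : ℝ) ≤ 0 := by exact_mod_cast hq
      have := mul_nonneg hh' (mul_self_nonneg (q : ℝ))
      have := mul_nonneg (norm_nonneg (k x)) (neg_nonneg.2 hq')
      have := mul_nonneg hC0 hh
      linarith
  have hdis := discrim_le_zero hreal
  rw [discrim] at hdis
  nlinarith

end

section

/-! ### From harmonic functions to multipliers -/

/-- A bounded sequence in a Hilbert space such that `u_k - u_n` is orthogonal to `u_n` for `n ≤ k`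
converges, since `‖u_k - u_n‖² = ‖u_k‖² - ‖u_n‖²`. -/
theorem exists_tendsto_of_inner_eq {E : Type*} [NormedAddCommGroup E] [InnerProductSpace ℂ E]
    [CompleteSpace E] {u : ℕ → E} (hu : ∀ n k, n ≤ k → inner ℂ (u n) (u k) = inner ℂ (u n) (u n))
    {C : ℝ} (hC : ∀ n, ‖u n‖ ≤ C) : ∃ v, Tendsto u atTop (𝓝 v) := by
  have h1 : ∀ n k, n ≤ k → ‖u k - u n‖ ^ 2 = ‖u k‖ ^ 2 - ‖u n‖ ^ 2 := by
    intro n k hnk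
    have h2 : RCLike.re (inner ℂ (u k) (u n)) = ‖u n‖ ^ 2 := by
      rw [inner_re_symm, hu n k hnk, inner_self_eq_norm_sq]
    rw [@norm_sub_sq ℂ, h2]
    ring
  have hmono : Monotone fun n => ‖u n‖ ^ 2 := fun n k hnk => by
    have := h1 n k hnk
    have := sq_nonneg ‖u k - u n‖
    dsimp only
    linarith
  have hbdd : BddAbove (Set.range fun n => ‖u n‖ ^ 2) := by
    refine ⟨C ^ 2, ?_⟩
    rintro _ ⟨n, rfl⟩
    exact pow_le_pow_left₀ (norm_nonneg _) (hC n) 2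
  have hcau := (tendsto_atTop_ciSup hmono hbdd).cauchySeq
  refine cauchySeq_tendsto_of_complete (Metric.cauchySeq_iff'.2 fun ε hε => ?_)
  obtain ⟨N, hN⟩ := Metric.cauchySeq_iff'.1 hcau (ε ^ 2) (by positivity)
  refine ⟨N, fun n hn => ?_⟩
  have h2 := hN n hn
  rw [Real.dist_eq, ← h1 N n hn, abs_of_nonneg (sq_nonneg _)] at h2
  rw [dist_eq_norm]
  exact lt_of_pow_lt_pow_left₀ 2 hε.le h2

variable {X : Type*} {r : X → X} {m m' : X → ℂ} {h h' : X → ℝ} {h₀ : X → ℂ}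

/-- The function `m⁽ⁿ⁾ h₀ / (m'⁽ⁿ⁾ h')`, which read at `x_n` is the conditional expectation, given
`x_n`, of the multiplier attached to `h₀`. Where `h'` vanishes its value is `0`; this set is null for
the marginals of `ν'`, and `h₀` vanishes on it almost everywhere. -/
noncomputable def harmonicRatio (r : X → X) (m m' : X → ℂ) (h' : X → ℝ) (h₀ : X → ℂ) (n : ℕ)
    (y : X) : ℂ :=
  cocycleProd r m n y * h₀ y / (cocycleProd r m' n y * h' y)

/-- The recursion along `r̂` that turns into the cocycle equation in the limit. -/
theorem harmonicRatio_rHat (hm' : ∀ x, m' x ≠ 0) (n : ℕ) (x : ProjLim r) :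
    m' (theta r 0 x) * harmonicRatio r m m' h' h₀ (n + 1) (theta r (n + 1) (rHat r x)) =
      m (theta r 0 x) * harmonicRatio r m m' h' h₀ n (theta r n x) := by
  have h1 := hm' (theta r 0 x)
  rw [harmonicRatio, harmonicRatio, theta_succ_rHat, cocycleProd_succ', cocycleProd_succ',
    iterate_theta_zero]
  by_cases h2 : cocycleProd r m' n (theta r n x) * (h' (theta r n x) : ℂ) = 0
  · rcases mul_eq_zero.1 h2 with h3 | h3 <;> simp [h3]
  · have h3 : cocycleProd r m' n (theta r n x) ≠ 0 := left_ne_zero_of_mul h2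
    have h4 : (h' (theta r n x) : ℂ) ≠ 0 := right_ne_zero_of_mul h2
    field_simp

variable [MeasurableSpace X] {μ : Measure X} {ν ν' : Measure (ProjLim r)} {S : Set (ProjLim r)}

theorem measurable_harmonicRatio (V : IsCovariantSystem r μ m h ν)
    (V' : IsCovariantSystem r μ m' h' ν') (hh₀ : Measurable h₀) (n : ℕ) :
    Measurable (harmonicRatio r m m' h' h₀ n) := by
  have h1 := measurable_cocycleProd V.dynamics.measurable V.pair.measurable n
  have h2 := measurable_cocycleProd V.dynamics.measurable V'.pair.measurable n
  have h3 := V'.pair.measurable_h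
  unfold harmonicRatio
  fun_prop

theorem IsCovariantSystem.integrable_comp_theta_iff (V : IsCovariantSystem r μ m h ν) (n : ℕ)
    {f : X → ℂ} (hf : Measurable f) :
    Integrable (fun x => f (theta r n x)) ν ↔
      Integrable (fun x => ((‖cocycleProd r m n x‖ ^ 2 * h x : ℝ) : ℂ) * f x) μ := by
  rw [show (fun x => f (theta r n x)) = f ∘ theta r n from rfl,
    ← integrable_map_measure hf.aestronglyMeasurable
    (measurable_theta n).aemeasurable, V.map_theta, marginal,
    integrable_withDensity_iff_integrable_smul'
      (V.pair.measurable_marginalWeight V.dynamics.measurable n)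
      (.of_forall fun x => by simp [marginalWeight, ENNReal.mul_lt_top_iff])]
  simp only [V.pair.toReal_marginalWeight, Complex.real_smul]

namespace IsMixedHarmonic

variable (V : IsCovariantSystem r μ m h ν) (V' : IsCovariantSystem r μ m' h' ν')
  (H : IsMixedHarmonic r μ m m' h h' h₀)
include H

theorem ae_eq_zero : ∀ᵐ x ∂μ, h' x = 0 → h₀ x = 0 := by
  obtain ⟨c, -, hc⟩ := H.bounded
  filter_upwards [hc] with x hx h0
  rw [h0, mul_zero] at hx
  simpa using hx

theorem integrable (P : IsRegularPair r μ m h) (P' : IsRegularPair r μ m' h') :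
    Integrable h₀ μ := by
  obtain ⟨c, hc0, hc⟩ := H.bounded
  refine ((P.integrable.const_mul c).add P'.integrable).mono' H.measurable.aestronglyMeasurable ?_
  filter_upwards [hc] with x hx
  have h1 := P.nonneg x
  have h2 := P'.nonneg x
  have h3 := mul_nonneg hc0 h1
  refine abs_le_of_sq_le_sq' ?_ (add_nonneg h3 h2) |>.2
  nlinarith [mul_nonneg h3 h2, sq_nonneg (c * h x), sq_nonneg (h' x)]

include V' in
theorem weight_mul_harmonicRatio (n : ℕ) : ∀ᵐ x ∂μ,
    ((‖cocycleProd r m' n x‖ ^ 2 * h' x : ℝ) : ℂ) * harmonicRatio r m m' h' h₀ n x =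
      conj (cocycleProd r m' n x) * cocycleProd r m n x * h₀ x := by
  filter_upwards [H.ae_eq_zero] with x hx
  have h1 := cocycleProd_ne_zero (r := r) V'.pair.ne_zero n x
  by_cases h0 : h' x = 0
  · simp [h0, hx h0]
  · have h2 : (h' x : ℂ) ≠ 0 := by exact_mod_cast h0
    rw [harmonicRatio, Complex.ofReal_mul, Complex.ofReal_pow, ← Complex.conj_mul']
    field_simp

include V V'

/-- The bound `|h₀|² ≤ c h h'`, transported to `X_∞`. -/
theorem lintegral_harmonicRatio_le : ∃ c : ℝ≥0, ∀ (n : ℕ) (B : Set X), MeasurableSet B →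
    ∫⁻ x in theta r n ⁻¹' B, ‖harmonicRatio r m m' h' h₀ n (theta r n x)‖ₑ ^ 2 ∂ν' ≤
      c * ν (theta r n ⁻¹' B) := by
  obtain ⟨c, hc0, hc⟩ := H.bounded
  refine ⟨c.toNNReal, fun n B hB => ?_⟩
  have hφ := measurable_harmonicRatio V V' H.measurable n
  have e : ∀ x, (theta r n ⁻¹' B).indicator
      (fun x => ‖harmonicRatio r m m' h' h₀ n (theta r n x)‖ₑ ^ 2) x =
        B.indicator (fun y => ‖harmonicRatio r m m' h' h₀ n y‖ₑ ^ 2) (theta r n x) := fun x => rfl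
  have e2 : ν (theta r n ⁻¹' B) = ∫⁻ x in B, marginalWeight r m h n x ∂μ := by
    rw [← Measure.map_apply (measurable_theta n) hB, V.map_theta, marginal, withDensity_apply _ hB]
  rw [← lintegral_indicator (measurable_theta n hB), lintegral_congr e,
    V'.lintegral_theta n ((hφ.enorm.pow_const 2).indicator hB), e2, ← lintegral_const_mul _
      (V.pair.measurable_marginalWeight V.dynamics.measurable n), ← lintegral_indicator hB]
  apply lintegral_mono_ae
  filter_upwards [hc] with x hx
  by_cases hxB : x ∈ B
  swap
  · simp [hxB]
  have h1 := cocycleProd_ne_zero (r := r) V'.pair.ne_zero n x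
  have hh := V.pair.nonneg x
  have hh' := V'.pair.nonneg x
  simp only [hxB, Set.indicator_of_mem, marginalWeight, ← ofReal_norm]
  rw [← ENNReal.ofReal_pow (norm_nonneg _), ← ENNReal.ofReal_pow (norm_nonneg _),
    ← ENNReal.ofReal_pow (norm_nonneg _), ← ENNReal.ofReal_mul (by positivity),
    ← ENNReal.ofReal_mul (by positivity), ← ENNReal.ofReal_mul (by positivity),
    ← ENNReal.ofReal, ← ENNReal.ofReal_mul hc0]
  apply ENNReal.ofReal_le_ofReal
  rw [harmonicRatio, norm_div, norm_mul, norm_mul, Complex.norm_real, Real.norm_of_nonneg hh']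
  rcases hh'.eq_or_lt with h0 | h0
  · rw [← h0]
    simp only [mul_zero, zero_mul]
    positivity
  · have h2 : ‖cocycleProd r m' n x‖ ≠ 0 := norm_ne_zero_iff.2 h1
    calc _ = ‖cocycleProd r m n x‖ ^ 2 * (‖h₀ x‖ ^ 2 / h' x) := by field_simp
      _ ≤ ‖cocycleProd r m n x‖ ^ 2 * (c * h x) := by
          gcongr
          rwa [div_le_iff₀ h0]
      _ = _ := by ring

theorem memLp_harmonicRatio (n : ℕ) :
    MemLp (fun x => harmonicRatio r m m' h' h₀ n (theta r n x)) 2 ν' := by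
  have := V.finite
  obtain ⟨c, hc⟩ := H.lintegral_harmonicRatio_le V V'
  refine ⟨((measurable_harmonicRatio V V' H.measurable n).comp
    (measurable_theta n)).aestronglyMeasurable, ?_⟩
  rw [eLpNorm_lt_top_iff_lintegral_rpow_enorm_lt_top (by simp) (by simp)]
  have h1 := hc n Set.univ .univ
  simp only [Set.preimage_univ, Measure.restrict_univ] at h1
  simpa using h1.trans_lt (ENNReal.mul_lt_top ENNReal.coe_lt_top (measure_lt_top _ _))

theorem integral_harmonicRatio_zero {g : X → ℂ} (hg : Measurable g) :
    ∫ x, g (theta r 0 x) * harmonicRatio r m m' h' h₀ 0 (theta r 0 x) ∂ν' =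
      ∫ x, g x * h₀ x ∂μ := by
  rw [V'.integral_theta 0 (f := fun x => g x * harmonicRatio r m m' h' h₀ 0 x)
    (hg.mul (measurable_harmonicRatio V V' H.measurable 0))]
  apply integral_congr_ae
  filter_upwards [H.weight_mul_harmonicRatio V' 0] with x hx
  rw [mul_left_comm, hx]
  simp

variable [IsProbabilityMeasure μ]

/-- The martingale property. It is the fixed point equation for `h₀`, transported by the marginals
of `ν'`. -/
theorem integral_harmonicRatio_succ (n : ℕ) {g : X → ℂ} (hg : Measurable g)
    (hgL : MemLp (fun x => g (theta r n x)) 2 ν') :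
    ∫ x, g (theta r n x) * harmonicRatio r m m' h' h₀ (n + 1) (theta r (n + 1) x) ∂ν' =
      ∫ x, g (theta r n x) * harmonicRatio r m m' h' h₀ n (theta r n x) ∂ν' := by
  have D := V.dynamics
  have hgr : ∀ x : ProjLim r, g (theta r n x) = g (r (theta r (n + 1) x)) := fun x =>
    congrArg g (x.2 n).symm
  have hm1 : Measurable fun y => g (r y) * harmonicRatio r m m' h' h₀ (n + 1) y :=
    (hg.comp D.measurable).mul (measurable_harmonicRatio V V' H.measurable (n + 1))
  have hi : Integrable (fun x => g (r (theta r (n + 1) x)) *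
      harmonicRatio r m m' h' h₀ (n + 1) (theta r (n + 1) x)) ν' := by
    simp only [← hgr]
    exact hgL.integrable_mul (H.memLp_harmonicRatio V V' (n + 1))
  rw [V'.integrable_comp_theta_iff (n + 1) hm1] at hi
  have e1 : (fun x => ((‖cocycleProd r m' (n + 1) x‖ ^ 2 * h' x : ℝ) : ℂ) *
      (g (r x) * harmonicRatio r m m' h' h₀ (n + 1) x)) =ᵐ[μ] fun x =>
      (g (r x) * conj (cocycleProd r m' n (r x)) * cocycleProd r m n (r x)) *
        (conj (m' x) * m x * h₀ x) := by
    filter_upwards [H.weight_mul_harmonicRatio V' (n + 1)] with x hx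
    rw [mul_left_comm, hx, cocycleProd_succ, cocycleProd_succ, map_mul]
    ring
  simp only [hgr]
  rw [V'.integral_theta (n + 1) hm1, integral_congr_ae e1, ← D.integral_fibreAvg (hi.congr e1),
    fibreAvg_comp_mul D.finite (fun x => g x * conj (cocycleProd r m' n x) * cocycleProd r m n x)]
  simp only [← hgr]
  rw [V'.integral_theta n (f := fun x => g x * harmonicRatio r m m' h' h₀ n x)
    (hg.mul (measurable_harmonicRatio V V' H.measurable n))]
  apply integral_congr_ae
  filter_upwards [H.weight_mul_harmonicRatio V' n, H.fixed] with x hx hx'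
  rw [mul_left_comm, hx]
  change _ * mixedRuelleOp r m m' h₀ x = _
  rw [hx']
  ring

theorem integral_harmonicRatio_of_le {n k : ℕ} (hnk : n ≤ k) {g : X → ℂ} (hg : Measurable g)
    (hgL : MemLp (fun x => g (theta r n x)) 2 ν') :
    ∫ x, g (theta r n x) * harmonicRatio r m m' h' h₀ k (theta r k x) ∂ν' =
      ∫ x, g (theta r n x) * harmonicRatio r m m' h' h₀ n (theta r n x) ∂ν' := by
  obtain ⟨j, rfl⟩ := Nat.exists_eq_add_of_le hnk
  clear hnk
  induction j with
  | zero => rfl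
  | succ j ih =>
    have hD := V.dynamics.measurable
    have e : ∀ x, g (theta r n x) = g (r^[j] (theta r (n + j) x)) := fun x => by
      rw [iterate_theta]
    rw [← ih]
    simp only [e] at hgL ⊢
    exact H.integral_harmonicRatio_succ V V' (n + j) (g := fun y => g (r^[j] y))
      (hg.comp (hD.iterate j)) hgL

/-- The martingale `m⁽ⁿ⁾ h₀ / (m'⁽ⁿ⁾ h')` at `x_n` converges in `L²(ν')`, and its limit is a
multiplier whose conditional expectation given `x₀` is `h₀ / h'`. -/
theorem exists_isMultiplier (hS : MeasurableSet S) (hS0 : ν S = 0) (hac : ν'.restrict Sᶜ ≪ ν) :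
    ∃ f, IsMultiplier r m m' ν ν' S f ∧ ∀ g : X → ℂ, Measurable g → (∃ C : ℝ, ∀ x, ‖g x‖ ≤ C) →
      ∫ x, g (theta r 0 x) * f x ∂ν' = ∫ x, g x * h₀ x ∂μ := by
  have := V.finite
  have := V'.finite
  have D := V.dynamics
  let F : ℕ → ProjLim r → ℂ := fun n x => harmonicRatio r m m' h' h₀ n (theta r n x)
  have hφm := measurable_harmonicRatio V V' H.measurable
  have hF : ∀ n, MemLp (F n) 2 ν' := H.memLp_harmonicRatio V V'
  let u : ℕ → Lp ℂ 2 ν' := fun n => (hF n).toLp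
  have hu : ∀ n, u n =ᵐ[ν'] F n := fun n => (hF n).coeFn_toLp
  obtain ⟨c, hc⟩ := H.lintegral_harmonicRatio_le V V'
  have hinner : ∀ n k, n ≤ k → inner ℂ (u n) (u k) = inner ℂ (u n) (u n) := by
    intro n k hnk
    have e : ∀ j, inner ℂ (u n) (u j) = ∫ x, conj (F n x) * F j x ∂ν' := fun j => by
      rw [L2.inner_def]
      apply integral_congr_ae
      filter_upwards [hu n, hu j] with x hx hx'
      rw [hx, hx', RCLike.inner_apply, mul_comm]
    rw [e, e]
    exact H.integral_harmonicRatio_of_le V V' hnk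
      (g := fun y => conj (harmonicRatio r m m' h' h₀ n y))
      (Complex.continuous_conj.measurable.comp (hφm n)) (hF n).star
  -- On a cylinder over `x_n`, the later terms of the martingale are bounded by the measure `ν`.
  have hcyl : ∀ n k, n ≤ k → ∀ B : Set X, MeasurableSet B →
      eLpNorm (F k) 2 (ν'.restrict (theta r n ⁻¹' B)) ≤
        (c * ν (theta r n ⁻¹' B)) ^ (1 / 2 : ℝ) := by
    intro n k hnk B hB
    obtain ⟨B', hB', e⟩ := exists_eq_theta_preimage_of_le D.measurable hnk hB
    rw [e, eLpNorm_eq_lintegral_rpow_enorm_toReal (by simp) (by simp)]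
    simp only [ENNReal.toReal_ofNat, ENNReal.rpow_ofNat]
    gcongr
    exact hc k B' hB'
  have hunorm : ∀ n, ‖u n‖ ≤ ((c * ν Set.univ) ^ (1 / 2 : ℝ)).toReal := by
    intro n
    rw [Lp.norm_toLp]
    refine ENNReal.toReal_mono ?_ (by simpa using hcyl n n le_rfl Set.univ .univ)
    exact ENNReal.rpow_ne_top_of_nonneg (by norm_num)
      (ENNReal.mul_ne_top ENNReal.coe_ne_top (measure_ne_top _ _))
  obtain ⟨v, hv⟩ := exists_tendsto_of_inner_eq hinner hunorm
  have hvm : AEStronglyMeasurable v ν' := Lp.aestronglyMeasurable v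
  have hdist : Tendsto (fun n => eLpNorm (fun x => v x - F n x) 2 ν') atTop (𝓝 0) := by
    have h1 := (Lp.tendsto_Lp_iff_tendsto_eLpNorm'' F hF v (Lp.memLp v)).1 (by simpa using hv)
    refine h1.congr fun n => ?_
    rw [eLpNorm_sub_comm]
    rfl
  have hdom : IsDominated ν ν' v := by
    refine ⟨(Lp.stronglyMeasurable v).measurable, c, ?_⟩
    have hfin : IsFiniteMeasure (ν'.withDensity fun x => ‖v x‖ₑ ^ 2) := by
      refine isFiniteMeasure_withDensity ?_
      have := (Lp.memLp v).2
      rw [eLpNorm_lt_top_iff_lintegral_rpow_enorm_lt_top (by simp) (by simp)] at this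
      simpa using this.ne
    refine measure_le_of_isSetAlgebra (isSetAlgebra_cylinders D.measurable)
      generateFrom_cylinders ?_
    rintro _ ⟨n, B, hB, rfl⟩
    set E := theta r n ⁻¹' B with hE
    have h1 : eLpNorm v 2 (ν'.restrict E) ≤ (c * ν E) ^ (1 / 2 : ℝ) := by
      have h2 : Tendsto (fun k => (c * ν E) ^ (1 / 2 : ℝ) + eLpNorm (fun x => v x - F k x) 2 ν')
          atTop (𝓝 ((c * ν E) ^ (1 / 2 : ℝ))) := by
        simpa using tendsto_const_nhds.add hdist
      refine ge_of_tendsto h2 ?_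
      filter_upwards [eventually_ge_atTop n] with k hk
      calc eLpNorm v 2 (ν'.restrict E)
          = eLpNorm (F k + fun x => v x - F k x) 2 (ν'.restrict E) := by
            congr 1; ext x; simp
        _ ≤ eLpNorm (F k) 2 (ν'.restrict E) + eLpNorm (fun x => v x - F k x) 2 (ν'.restrict E) :=
            eLpNorm_add_le (hF k).1.restrict (hvm.sub (hF k).1).restrict (by norm_num)
        _ ≤ _ := add_le_add (hcyl n k hk B hB) (eLpNorm_mono_measure _ Measure.restrict_le_self)
    rw [eLpNorm_eq_lintegral_rpow_enorm_toReal (by simp) (by simp),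
      ENNReal.toReal_ofNat, ENNReal.rpow_le_rpow_iff (by norm_num)] at h1
    rw [withDensity_apply _ (measurable_theta n hB), Measure.smul_apply, ENNReal.smul_def,
      smul_eq_mul]
    simpa using h1
  have hcoc : ∀ᵐ x ∂ν', m (theta r 0 x) * v x = m' (theta r 0 x) * v (rHat r x) := by
    obtain ⟨C, hC⟩ := V.pair.bounded
    have hmm : AEStronglyMeasurable (fun x => m (theta r 0 x)) ν' :=
      (V.pair.measurable.comp (measurable_theta 0)).aestronglyMeasurable
    have hle : ∀ n,
        eLpNorm (fun x => m (theta r 0 x) * v x - m' (theta r 0 x) * v (rHat r x)) 2 ν' ≤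
        ENNReal.ofReal C * eLpNorm (fun x => v x - F n x) 2 ν' +
          eLpNorm (fun x => v x - F (n + 1) x) 2 ν' := by
      intro n
      have hd := hvm.sub (hF (n + 1)).1
      have hd' : AEStronglyMeasurable (fun x => m' (theta r 0 x) *
          (v (rHat r x) - F (n + 1) (rHat r x))) ν' :=
        (V'.pair.measurable.comp (measurable_theta 0)).aestronglyMeasurable.mul
          (hd.comp_quasiMeasurePreserving V'.quasiMeasurePreserving_rHat)
      calc eLpNorm (fun x => m (theta r 0 x) * v x - m' (theta r 0 x) * v (rHat r x)) 2 ν'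
          = eLpNorm ((fun x => m (theta r 0 x) * (v x - F n x)) -
              fun x => m' (theta r 0 x) * (v (rHat r x) - F (n + 1) (rHat r x))) 2 ν' := by
            congr 1
            ext x
            have := harmonicRatio_rHat (m := m) (h' := h') (h₀ := h₀) V'.pair.ne_zero n x
            simp only [Pi.sub_apply, F]
            linear_combination -this
        _ ≤ eLpNorm (fun x => m (theta r 0 x) * (v x - F n x)) 2 ν' +
              eLpNorm (fun x => m' (theta r 0 x) * (v (rHat r x) - F (n + 1) (rHat r x))) 2 ν' :=
            eLpNorm_sub_le (hmm.mul (hvm.sub (hF n).1)) hd' (by norm_num)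
        _ ≤ _ := by
            refine add_le_add ?_ (V'.eLpNorm_covU hd).le
            refine eLpNorm_le_mul_eLpNorm_of_ae_le_mul (.of_forall fun x => ?_) 2
            rw [norm_mul]
            gcongr
            exact hC _
    have h0 :
        eLpNorm (fun x => m (theta r 0 x) * v x - m' (theta r 0 x) * v (rHat r x)) 2 ν' = 0 := by
      have h1 := ENNReal.Tendsto.const_mul (a := ENNReal.ofReal C) hdist
        (.inr ENNReal.ofReal_ne_top)
      have h2 := h1.add (hdist.comp (tendsto_add_atTop_nat 1))
      rw [mul_zero, zero_add] at h2
      exact le_antisymm (ge_of_tendsto' h2 hle) zero_le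
    have h1 := (eLpNorm_eq_zero_iff ((hmm.mul hvm).sub
      ((V'.pair.measurable.comp (measurable_theta 0)).aestronglyMeasurable.mul
        (hvm.comp_quasiMeasurePreserving V'.quasiMeasurePreserving_rHat))) (by simp)).1 h0
    filter_upwards [h1] with x hx
    exact sub_eq_zero.1 hx
  obtain ⟨f, hf, hfv⟩ := hdom.exists_isMultiplier V' hS hS0 hac hcoc
  refine ⟨f, hf, fun g hg hgb => ?_⟩
  obtain ⟨C, hC⟩ := hgb
  rw [integral_congr_ae (hfv.mono fun x hx => by rw [hx])]
  have hgL : MemLp (fun x => g (theta r 0 x)) 2 ν' :=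
    MemLp.of_bound (hg.comp (measurable_theta 0)).aestronglyMeasurable C (.of_forall fun x => hC _)
  let G : Lp ℂ 2 ν' := hgL.star.toLp
  have hG : ∀ (w : Lp ℂ 2 ν'), inner ℂ G w = ∫ x, g (theta r 0 x) * w x ∂ν' := fun w => by
    rw [L2.inner_def]
    apply integral_congr_ae
    filter_upwards [hgL.star.coeFn_toLp] with x hx
    rw [hx, RCLike.inner_apply]
    simp [mul_comm]
  have h1 : Tendsto (fun n => inner ℂ G (u n)) atTop (𝓝 (inner ℂ G v)) :=
    tendsto_const_nhds.inner hv
  rw [← hG]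
  refine tendsto_nhds_unique h1 (tendsto_const_nhds.congr fun n => ?_)
  rw [hG, integral_congr_ae ((hu n).mono fun x hx => by rw [hx]),
    H.integral_harmonicRatio_of_le V V' n.zero_le hg hgL,
    H.integral_harmonicRatio_zero V V' hg]

end IsMixedHarmonic

end

section

variable {X : Type*} {r : X → X} [MeasurableSpace X] {μ : Measure X}

theorem IsDynamics.ruelleOp_congr_ae [IsProbabilityMeasure μ] (D : IsDynamics r μ)
    {m n ξ η : X → ℂ} (hmn : m =ᵐ[μ] n) (hξη : ξ =ᵐ[μ] η) :
    ruelleOp r m ξ =ᵐ[μ] ruelleOp r n η := by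
  apply D.fibreAvg_congr_ae
  filter_upwards [hmn, hξη] with x h1 h2
  rw [h1, h2]

theorem IsDynamics.iterate_ruelleOp_congr_ae [IsProbabilityMeasure μ] (D : IsDynamics r μ)
    {m n ξ η : X → ℂ} (hmn : m =ᵐ[μ] n) (hξη : ξ =ᵐ[μ] η) (j : ℕ) :
    (ruelleOp r m)^[j] ξ =ᵐ[μ] (ruelleOp r n)^[j] η := by
  induction j with
  | zero => exact hξη
  | succ j ih =>
    rw [Function.iterate_succ_apply', Function.iterate_succ_apply']
    exact D.ruelleOp_congr_ae hmn ih

/-! ### Passage to regular representatives -/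

/-- The values of `m` on the null set where it vanishes or exceeds its essential bound are replaced
by `1`, and `h` is replaced by its positive part. -/
theorem IsPRFPair.exists_isRegularPair [IsProbabilityMeasure μ] (D : IsDynamics r μ)
    {m : X → ℂ} {h : X → ℝ} (hp : IsPRFPair r μ m h) (hns : NonSingular μ m) :
    ∃ n k, IsRegularPair r μ n k ∧ m =ᵐ[μ] n ∧ h =ᵐ[μ] k := by
  obtain ⟨m₁, hm₁, hmm₁⟩ := hp.memLp_top.1.aemeasurable
  obtain ⟨h₁, hh₁, hhh₁⟩ := hp.integrable.1.aemeasurable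
  obtain ⟨C, hC⟩ := exists_ae_norm_le hp.memLp_top
  let T : Set X := {x | m₁ x ≠ 0 ∧ ‖m₁ x‖ ≤ C}
  have hT : MeasurableSet T :=
    (hm₁ (measurableSet_singleton 0).compl).inter (measurableSet_le hm₁.norm measurable_const)
  classical
  let n : X → ℂ := T.piecewise m₁ fun _ => 1
  let k : X → ℝ := fun x => max (h₁ x) 0
  have hmn : m =ᵐ[μ] n := by
    filter_upwards [hmm₁, hC, hns] with x h1 h2 h3
    have : x ∈ T := ⟨h1 ▸ h3, h1 ▸ h2⟩
    simp [n, this, h1]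
  have hhk : h =ᵐ[μ] k := by
    filter_upwards [hhh₁, hp.nonneg] with x h1 h2
    simp only [k]
    rw [← h1, max_eq_left (show 0 ≤ h x from h2)]
  refine ⟨n, k, ⟨hm₁.piecewise hT measurable_const, ⟨max C 1, fun x => ?_⟩, fun x => ?_,
    hh₁.max measurable_const, hp.integrable.congr hhk, fun x => le_max_right _ _, ?_⟩, hmn, hhk⟩
  · by_cases hx : x ∈ T
    · simpa [n, hx] using Or.inl hx.2
    · simp [n, hx]
  · by_cases hx : x ∈ T
    · simpa [n, hx] using hx.1
    · simp [n, hx]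
  · have hc : (fun x => (h x : ℂ)) =ᵐ[μ] fun x => (k x : ℂ) := hhk.mono fun x hx => by simp [hx]
    exact ((D.ruelleOp_congr_ae hmn hc).symm.trans hp.ruelle_eq).trans hc

theorem pathMeasure_congr [IsProbabilityMeasure μ] (D : IsDynamics r μ) {m n : X → ℂ}
    {h k : X → ℝ} (hmn : m =ᵐ[μ] n) (hhk : h =ᵐ[μ] k) :
    pathMeasure r μ m h = pathMeasure r μ n k := by
  have key : ∀ (j : ℕ) (f : X → ℂ), ∫ x, (ruelleOp r m)^[j] (fun y => f y * (h y : ℂ)) x ∂μ =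
      ∫ x, (ruelleOp r n)^[j] (fun y => f y * (k y : ℂ)) x ∂μ := fun j f =>
    integral_congr_ae (D.iterate_ruelleOp_congr_ae hmn (hhk.mono fun x hx => by simp [hx]) j)
  rw [pathMeasure, pathMeasure]
  congr 1
  ext ν
  constructor
  · rintro ⟨h1, h2⟩
    exact ⟨h1, fun j f hf hb => (h2 j f hf hb).trans (key j f)⟩
  · rintro ⟨h1, h2⟩
    exact ⟨h1, fun j f hf hb => (h2 j f hf hb).trans (key j f).symm⟩

theorem IsRegularPair.isCovariantSystem [StandardBorelSpace X] [IsProbabilityMeasure μ]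
    {m : X → ℂ} {h : X → ℝ} (P : IsRegularPair r μ m h) (D : IsDynamics r μ) :
    IsCovariantSystem r μ m h (pathMeasure r μ m h) := by
  have h1 := (P.isPathMeasure_iff D).1 (Classical.epsilon_spec (P.exists_isPathMeasure D))
  exact ⟨D, P, h1.1, h1.2⟩

section Congr

variable {m n m' n' : X → ℂ} {h k h' k' : X → ℝ} {ν ν' : Measure (ProjLim r)}
  {S : Set (ProjLim r)}

theorem covU_congr (hq : Measure.QuasiMeasurePreserving (theta r 0) ν μ) (hmn : m =ᵐ[μ] n) :
    covU r m ν = covU r n ν := by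
  ext1 ξ
  exact toL2_congr ((hq.ae hmn).mono fun x hx => by simp [hx])

theorem intertwiners_congr (hq : Measure.QuasiMeasurePreserving (theta r 0) ν μ)
    (hq' : Measure.QuasiMeasurePreserving (theta r 0) ν' μ) (hmn : m =ᵐ[μ] n)
    (hmn' : m' =ᵐ[μ] n') : intertwiners r μ m m' ν ν' = intertwiners r μ n n' ν ν' := by
  rw [intertwiners, intertwiners, covU_congr hq hmn, covU_congr hq' hmn']

/-- Being a multiplier does not depend on the representatives of `m` and `m'`. -/
theorem isMultiplier_congr (hq' : Measure.QuasiMeasurePreserving (theta r 0) ν' μ)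
    (hmn : m =ᵐ[μ] n) (hmn' : m' =ᵐ[μ] n') :
    IsMultiplier r m m' ν ν' S = IsMultiplier r n n' ν ν' S := by
  ext f
  have e : (∀ᵐ x ∂ν', m (theta r 0 x) * f x = m' (theta r 0 x) * f (rHat r x)) ↔
      ∀ᵐ x ∂ν', n (theta r 0 x) * f x = n' (theta r 0 x) * f (rHat r x) := by
    apply eventually_congr
    filter_upwards [hq'.ae hmn, hq'.ae hmn'] with x h1 h2
    rw [h1, h2]
  exact ⟨fun H => ⟨H.1, H.2, H.3, e.1 H.4⟩, fun H => ⟨H.1, H.2, H.3, e.2 H.4⟩⟩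

theorem isMixedHarmonic_congr [IsProbabilityMeasure μ] (D : IsDynamics r μ) (hmn : m =ᵐ[μ] n)
    (hmn' : m' =ᵐ[μ] n') (hhk : h =ᵐ[μ] k) (hhk' : h' =ᵐ[μ] k') :
    IsMixedHarmonic r μ m m' h h' = IsMixedHarmonic r μ n n' k k' := by
  ext h₀
  have e1 : ∀ c : ℝ, (∀ᵐ x ∂μ, ‖h₀ x‖ ^ 2 ≤ c * h x * h' x) ↔
      ∀ᵐ x ∂μ, ‖h₀ x‖ ^ 2 ≤ c * k x * k' x := fun c => by
    apply eventually_congr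
    filter_upwards [hhk, hhk'] with x h1 h2
    rw [h1, h2]
  have e2 : mixedRuelleOp r m m' h₀ =ᵐ[μ] mixedRuelleOp r n n' h₀ := by
    apply D.fibreAvg_congr_ae
    filter_upwards [hmn, hmn'] with x h1 h2
    rw [h1, h2]
  constructor
  · rintro ⟨h1, ⟨c, hc0, hc⟩, h3⟩
    exact ⟨h1, ⟨c, hc0, (e1 c).1 hc⟩, e2.symm.trans h3⟩
  · rintro ⟨h1, ⟨c, hc0, hc⟩, h3⟩
    exact ⟨h1, ⟨c, hc0, (e1 c).2 hc⟩, e2.trans h3⟩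

end Congr

/-! ### The correspondences -/

variable {m m' : X → ℂ} {h h' : X → ℝ} {ν ν' : Measure (ProjLim r)} {S : Set (ProjLim r)}

theorem IsDominated.apply_covPhi (V : IsCovariantSystem r μ m h ν) {f : ProjLim r → ℂ}
    (hf : IsDominated ν ν' f) {A : Lp ℂ 2 ν →L[ℂ] Lp ℂ 2 ν'}
    (hA : ∀ ξ : Lp ℂ 2 ν, A ξ =ᵐ[ν'] fun x => f x * ξ x) : A (covPhi r ν) =ᵐ[ν'] f := by
  refine (hA _).trans ((hf.mul_congr V.coeFn_covPhi).trans (.of_forall fun x => ?_))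
  simp

/-- An intertwiner is multiplication by any representative of the image of `φ = 1`. -/
theorem intertwiner_apply (V : IsCovariantSystem r μ m h ν) (V' : IsCovariantSystem r μ m' h' ν')
    (hS : MeasurableSet S) (hS0 : ν S = 0) (hac : ν'.restrict Sᶜ ≪ ν)
    {A : Lp ℂ 2 ν →L[ℂ] Lp ℂ 2 ν'} (hA : A ∈ intertwiners r μ m m' ν ν') {f : ProjLim r → ℂ}
    (hf : A (covPhi r ν) =ᵐ[ν'] f) (ξ : Lp ℂ 2 ν) : A ξ =ᵐ[ν'] fun x => f x * ξ x := by
  have := V.finite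
  have := V'.finite
  obtain ⟨k, hk, hAk⟩ := exists_isMultiplier_of_intertwiner V V' hS hS0 hac hA
  have hkf := ((hk.isDominated hS hac).apply_covPhi V hAk).symm.trans hf
  exact (hAk ξ).trans (hkf.mono fun x hx => by simp [hx])

theorem exists_equiv_intertwiners_multipliers (V : IsCovariantSystem r μ m h ν)
    (V' : IsCovariantSystem r μ m' h' ν') (hS : MeasurableSet S) (hS0 : ν S = 0)
    (hac : ν'.restrict Sᶜ ≪ ν) :
    ∃ Φ : intertwiners r μ m m' ν ν' ≃ multipliers r m m' ν ν' S,
      ∀ A, (Φ A).1 = (A.1 (covPhi r ν)).1 := by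
  have := V.finite
  have := V'.finite
  have hmem : ∀ A : intertwiners r μ m m' ν ν',
      (A.1 (covPhi r ν)).1 ∈ multipliers r m m' ν ν' S := fun A => by
    obtain ⟨k, hk, hAk⟩ := exists_isMultiplier_of_intertwiner V V' hS hS0 hac A.2
    exact ⟨k, hk, (hk.isDominated hS hac).apply_covPhi V hAk⟩
  let T : intertwiners r μ m m' ν ν' → multipliers r m m' ν ν' S := fun A => ⟨_, hmem A⟩
  refine ⟨Equiv.ofBijective T ⟨fun A B hAB => ?_, fun F => ?_⟩, fun A => rfl⟩
  · have e : A.1 (covPhi r ν) = B.1 (covPhi r ν) := 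
      Subtype.ext (congrArg (fun F : multipliers r m m' ν ν' S => F.1) hAB)
    refine Subtype.ext (ContinuousLinearMap.ext fun ξ => Lp.ext ?_)
    have h1 := intertwiner_apply V V' hS hS0 hac A.2 (EventuallyEq.refl _ _) ξ
    rw [e] at h1
    exact h1.trans (intertwiner_apply V V' hS hS0 hac B.2 (EventuallyEq.refl _ _) ξ).symm
  · obtain ⟨f, hf, hFf⟩ := F.2
    obtain ⟨A, hA, hAf⟩ := hf.exists_intertwiner V V' hS hac
    refine ⟨⟨A, hA⟩, Subtype.ext (AEEqFun.ext ?_)⟩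
    exact ((hf.isDominated hS hac).apply_covPhi V hAf).trans hFf.symm

theorem ae_eq_condE₀_mul (V' : IsCovariantSystem r μ m' h' ν') {f : ProjLim r → ℂ}
    (hi : Integrable f ν') {k : X → ℂ} (hk : Integrable k μ)
    (hfk : ∀ g : X → ℂ, Measurable g → (∃ C : ℝ, ∀ x, ‖g x‖ ≤ C) →
      ∫ x, g (theta r 0 x) * f x ∂ν' = ∫ x, g x * k x ∂μ) :
    (fun x => condE₀ r ν' f x * (h' x : ℂ)) =ᵐ[μ] k := by
  refine ae_eq_of_integral_indicator_mul (V'.integrable_condE₀_mul f) hk fun s hs => ?_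
  rw [← V'.integral_mul_condE₀ hi (memLp_top_indicator hs)]
  exact hfk _ (measurable_const.indicator hs)
    ⟨1, fun x => by by_cases hx : x ∈ s <;> simp [hx]⟩

theorem memLp_top_of_bounded {g : X → ℂ} (hg : Measurable g) (hb : ∃ C : ℝ, ∀ x, ‖g x‖ ≤ C) :
    MemLp g ∞ μ :=
  memLp_top_of_bound hg.aestronglyMeasurable _ (.of_forall hb.choose_spec)

theorem condE₀_mul_congr (V' : IsCovariantSystem r μ m' h' ν') {f k : ProjLim r → ℂ}
    (hf : Integrable f ν') (hfk : f =ᵐ[ν'] k) :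
    (fun x => condE₀ r ν' f x * (h' x : ℂ)) =ᵐ[μ] fun x => condE₀ r ν' k x * (h' x : ℂ) := by
  refine ae_eq_condE₀_mul V' hf (V'.integrable_condE₀_mul k) fun g hg hb => ?_
  rw [← V'.integral_mul_condE₀ (hf.congr hfk) (memLp_top_of_bounded hg hb)]
  exact integral_congr_ae (hfk.mono fun x hx => by simp [hx])

theorem exists_equiv_multipliers_mixedHarmonics [IsProbabilityMeasure μ]
    (V : IsCovariantSystem r μ m h ν) (V' : IsCovariantSystem r μ m' h' ν')
    (hS : MeasurableSet S) (hS0 : ν S = 0) (hac : ν'.restrict Sᶜ ≪ ν) :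
    ∃ Ψ : multipliers r m m' ν ν' S ≃ mixedHarmonics r μ m m' h h',
      ∀ F f, IsMultiplier r m m' ν ν' S f → F.1 =ᵐ[ν'] f →
        (Ψ F).1 =ᵐ[μ] fun x => condE₀ r ν' f x * (h' x : ℂ) := by
  have := V.finite
  have := V'.finite
  choose φ hφ hFφ using fun F : multipliers r m m' ν ν' S => F.2
  have hm : ∀ f : ProjLim r → ℂ, Measurable fun x => condE₀ r ν' f x * (h' x : ℂ) := fun f => by
    have h1 := measurable_condE₀ ν' f
    have h2 := V'.pair.measurable_h
    fun_prop
  have hi : ∀ F, Integrable (φ F) ν' := fun F => (hφ F).integrable V V' hS hac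
  have hH : ∀ F, IsMixedHarmonic r μ m m' h h' fun x => condE₀ r ν' (φ F) x * (h' x : ℂ) :=
    fun F => ⟨hm _, norm_condE₀_mul_sq_le V V' ((hφ F).isDominated hS hac),
      mixedRuelleOp_condE₀_mul V' V.pair.measurable V.pair.bounded (hi F) (hφ F).cocycle⟩
  let T : multipliers r m m' ν ν' S → mixedHarmonics r μ m m' h h' := fun F =>
    ⟨AEEqFun.mk _ (hm (φ F)).aestronglyMeasurable, _, hH F, AEEqFun.coeFn_mk _ _⟩
  have hT : ∀ F, (T F).1 =ᵐ[μ] fun x => condE₀ r ν' (φ F) x * (h' x : ℂ) :=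
    fun F => AEEqFun.coeFn_mk _ _
  refine ⟨Equiv.ofBijective T ⟨fun F G hFG => ?_, fun K => ?_⟩, fun F f hf hFf => ?_⟩
  · have h1 : (fun x => condE₀ r ν' (φ F) x * (h' x : ℂ)) =ᵐ[μ]
        fun x => condE₀ r ν' (φ G) x * (h' x : ℂ) := by
      refine (hT F).symm.trans ?_
      rw [hFG]
      exact hT G
    have h2 : (fun x => φ F x - φ G x) =ᵐ[ν'] 0 := by
      refine ae_eq_zero_of_cocycle (m := m) V' V.pair.measurable V.pair.bounded
        ((hi F).sub (hi G)) ?_ fun g hg hb => ?_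
      · filter_upwards [(hφ F).cocycle, (hφ G).cocycle] with x hx1 hx2
        rw [mul_sub, mul_sub, hx1, hx2]
      · obtain ⟨C, hC⟩ := hb
        have hgm : MemLp g ∞ μ := memLp_top_of_bounded hg ⟨C, hC⟩
        have hgi : ∀ F, Integrable (fun x => g (theta r 0 x) * φ F x) ν' := fun F =>
          (hi F).bdd_mul (hg.comp (measurable_theta 0)).aestronglyMeasurable
            (.of_forall fun x => hC _)
        simp only [mul_sub]
        rw [integral_sub (hgi F) (hgi G), V'.integral_mul_condE₀ (hi F) hgm,
          V'.integral_mul_condE₀ (hi G) hgm, sub_eq_zero]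
        exact integral_congr_ae (h1.mono fun x hx => by simp only at hx ⊢; rw [hx])
    refine Subtype.ext (AEEqFun.ext ?_)
    filter_upwards [hFφ F, hFφ G, h2] with x hx1 hx2 hx3
    rw [hx1, hx2]
    exact sub_eq_zero.1 hx3
  · obtain ⟨h₀, hh₀, hK⟩ := K.2
    obtain ⟨f, hf, hfh⟩ := hh₀.exists_isMultiplier V V' hS hS0 hac
    let F : multipliers r m m' ν ν' S :=
      ⟨AEEqFun.mk f hf.measurable.aestronglyMeasurable, f, hf, AEEqFun.coeFn_mk _ _⟩
    refine ⟨F, Subtype.ext (AEEqFun.ext ?_)⟩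
    have hFf : φ F =ᵐ[ν'] f := (hFφ F).symm.trans (AEEqFun.coeFn_mk _ _)
    exact ((hT F).trans (condE₀_mul_congr V' (hi F) hFf)).trans
      ((ae_eq_condE₀_mul V' (hf.integrable V V' hS hac) (hh₀.integrable V.pair V'.pair) hfh).trans
        hK.symm)
  · exact (hT F).trans (condE₀_mul_congr V' (hi F) ((hFφ F).symm.trans hFf))

theorem inner_covPhi_apply (V : IsCovariantSystem r μ m h ν)
    (V' : IsCovariantSystem r μ m' h' ν') {f : ProjLim r → ℂ} (hf : IsDominated ν ν' f)
    {A : Lp ℂ 2 ν →L[ℂ] Lp ℂ 2 ν'} (hA : ∀ ξ : Lp ℂ 2 ν, A ξ =ᵐ[ν'] fun x => f x * ξ x)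
    {g : X → ℂ} (hg : MemLp g ∞ μ) :
    inner ℂ (covPhi r ν') (A (covPi r ν g (covPhi r ν))) =
      ∫ x, g x * (condE₀ r ν' f x * (h' x : ℂ)) ∂μ := by
  have := V.finite
  have := V'.finite
  rw [← V'.integral_mul_condE₀ (hf.memLp.integrable (by norm_num)) hg, L2.inner_def]
  apply integral_congr_ae
  filter_upwards [V'.coeFn_covPhi, hA (covPi r ν g (covPhi r ν)),
    hf.mul_congr (V.coeFn_covPi hg (covPhi r ν)), hf.mul_congr V.coeFn_covPhi]
    with x hx1 hx2 hx3 hx4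
  rw [hx1, hx2, hx3, RCLike.inner_apply, map_one, mul_one, mul_left_comm, hx4, mul_one]

end

end Ruelle

open Ruelle in
theorem theorem6p2 {X : Type*} [MetricSpace X] [CompactSpace X] [MeasurableSpace X] [BorelSpace X]
    (r : X → X) (hr : Measurable r) (hr_onto : Function.Surjective r)
    (hr_fin : ∀ x, (r ⁻¹' {x}).Finite)
    (μ : Measure X) [IsProbabilityMeasure μ] (hμ : StronglyInvariant r μ)
    (m₀ m₀' : X → ℂ) (h h' : X → ℝ)
    (hpair : IsPRFPair r μ m₀ h) (hpair' : IsPRFPair r μ m₀' h')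
    (hns : NonSingular μ m₀) (hns' : NonSingular μ m₀')
    -- the measures `ν = μ̂` and `ν' = μ̂'` on `X_∞`
    (ν ν' : Measure (ProjLim r))
    (hν : ν = pathMeasure r μ m₀ h) (hν' : ν' = pathMeasure r μ m₀' h')
    -- the decomposition of `X_∞` into the singular part `S` and the absolutely continuous part `Sᶜ`
    (S : Set (ProjLim r)) (hS : MeasurableSet S) (hS_null : ν S = 0)
    (hS_ac : ν'.restrict Sᶜ ≪ ν) :
    ∃ (Φ : intertwiners r μ m₀ m₀' ν ν' ≃ multipliers r m₀ m₀' ν ν' S)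
      (Ψ : multipliers r m₀ m₀' ν ν' S ≃ mixedHarmonics r μ m₀ m₀' h h'),
      -- from operators to functions on `X_∞`: `A = M_f`
      (∀ (A : intertwiners r μ m₀ m₀' ν ν') (f : ProjLim r → ℂ),
        IsMultiplier r m₀ m₀' ν ν' S f → (Φ A).1 =ᵐ[ν'] f →
          ∀ ξ : Lp ℂ 2 ν, A.1 ξ =ᵐ[ν'] fun x => f x * ξ x) ∧
      -- from functions on `X_∞` to functions on `X`: `h₀ = E₀^{ν'}(f) h' = E₀^ν(f Δ) h`
      (∀ (F : multipliers r m₀ m₀' ν ν' S) (f : ProjLim r → ℂ),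
        IsMultiplier r m₀ m₀' ν ν' S f → F.1 =ᵐ[ν'] f →
          (Ψ F).1 =ᵐ[μ] (fun x => condE₀ r ν' f x * (h' x : ℂ)) ∧
          (Ψ F).1 =ᵐ[μ] (fun x =>
            condE₀ r ν (fun y => f y * (density ν ν' S y : ℂ)) x * (h x : ℂ))) ∧
      -- from operators to functions on `X`: `⟨φ', A π(g) φ⟩ = ∫ g h₀ dμ`
      (∀ (A : intertwiners r μ m₀ m₀' ν ν') (g : X → ℂ), MemLp g ∞ μ →
        inner ℂ (covPhi r ν') (A.1 (covPi r ν g (covPhi r ν))) =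
          ∫ x, g x * (Ψ (Φ A)).1 x ∂μ) := by
  have D : IsDynamics r μ := ⟨hr, hr_onto, hr_fin, hμ⟩
  obtain ⟨n, k, P, hmn, hhk⟩ := hpair.exists_isRegularPair D hns
  obtain ⟨n', k', P', hmn', hhk'⟩ := hpair'.exists_isRegularPair D hns'
  have V : IsCovariantSystem r μ n k ν := by
    rw [hν, pathMeasure_congr D hmn hhk]
    exact P.isCovariantSystem D
  have V' : IsCovariantSystem r μ n' k' ν' := by
    rw [hν', pathMeasure_congr D hmn' hhk']
    exact P'.isCovariantSystem D
  have hq := V.quasiMeasurePreserving_theta 0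
  have hq' := V'.quasiMeasurePreserving_theta 0
  have hmul := isMultiplier_congr (S := S) (ν := ν) hq' hmn hmn'
  have hI := intertwiners_congr hq hq' hmn hmn'
  have hM : multipliers r m₀ m₀' ν ν' S = multipliers r n n' ν ν' S := by
    rw [multipliers, multipliers, hmul]
  have hH : mixedHarmonics r μ m₀ m₀' h h' = mixedHarmonics r μ n n' k k' := by
    rw [mixedHarmonics, mixedHarmonics, isMixedHarmonic_congr D hmn hmn' hhk hhk']
  rw [hI, hM, hH, hmul]
  have := V.finite
  have := V'.finite
  obtain ⟨Φ, hΦ⟩ := exists_equiv_intertwiners_multipliers V V' hS hS_null hS_ac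
  obtain ⟨Ψ, hΨ⟩ := exists_equiv_multipliers_mixedHarmonics V V' hS hS_null hS_ac
  refine ⟨Φ, Ψ, fun A f _ hAf ξ => ?_, fun F f hf hFf => ⟨?_, ?_⟩, fun A g hg => ?_⟩
  · rw [hΦ] at hAf
    exact intertwiner_apply V V' hS hS_null hS_ac A.2 hAf ξ
  · exact (hΨ F f hf hFf).trans (hhk'.mono fun x hx => by simp [hx])
  · exact ((hΨ F f hf hFf).trans (hf.condE₀_mul_eq V V' hS hS_ac)).trans
      (hhk.mono fun x hx => by simp [hx])
  · obtain ⟨f, hf, hAf⟩ := (Φ A).2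
    have hA := intertwiner_apply V V' hS hS_null hS_ac A.2 (f := f) (by rwa [← hΦ])
    rw [inner_covPhi_apply V V' (hf.isDominated hS hS_ac) hA hg]
    exact integral_congr_ae ((hΨ (Φ A) f hf hAf).mono fun x hx => by simp [hx])
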